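/- **Conventions.** An *excitation model* $m=(A,S,\partial,\operatorname{supp})$ in a space $M$ consists of an abelian group $A$, a set $S$, a map $\partial:S\to A$ whose image generates $A$, and subsets $\operatorname{supp}(s)\subset M$ ($s\in S$). Extend $\partial$ to the free group $F(S)$. Let $E(m)$ be the free abelian group on symbols $\theta(s,a)$ ($s\in S$, $a\in A$), and define $\theta(g,a)\in E(m)$ for $g\in F(S)$ by $\theta(1,a)=0$, $\theta(gh,a)=\theta(h,a)+\theta(g,a+\partial h)$. With $[x,y]=x^{-1}y^{-1}xy$, let $E_{\rm id}(m)$ be generated by all $\theta([s_k,[\cdots,[s_2,s_1]]],a)$ with $k\ge 2$, $a\in A$ and $\bigcap_i\operatorname{supp}(s_i)=\emptyset$. Let $E_{\rm inv}(m)$ be the group of all $e\in E(m)$ such that (i) $e$ is closed, i.e. is in the kernel of $\theta(s,a)\mapsto[a+\partial s]-[a]\in\mathbb Z[A]$, and (ii) for every $V\subset S$ whose members' supports have a common point, $e$ is killed by the map sending $\theta(s,a)$ to $\theta(s,[a])$, $[a]\in A/\langle\partial t: t\notin V\rangle$, if $s\in V$, and to $0$ if $s\notin V$. The *statistics* of $m$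 is $T(m)=E_{\rm inv}(m)/E_{\rm id}(m)$. Let $C$ be an oriented regular cell complex (a regular CW complex, not necessarily finite), $G$ an abelian group, $G_0\subset G$ a generating subset, and $p\ge -1$. Given an embedding $f$ of the $(p+1)$-skeleton of $C$ in a space $M$, the *lattice model* $m_p(C,f)$ of $p$-dimensional excitations with fusion group $G$ has $A=B_p(C;G)$, $S=\{(p+1)\text{-cells of }C\}\times G_0$, $\partial(c,g)=g\,\partial c$ and $\operatorname{supp}(c,g)=f(\bar c)$, where $\bar c$ is the closed cell. Here $B_p(C;G)$ is the image of the boundary map on cellular $(p+1)$-chains (for $p=-1$: the image of the augmentation $C_0(C;G)\to G$). **Corollary.** Let $d\ge 0$. 1. If $p=d-1$ and $f$ embeds the $d$-skeleton of $C$ in $\mathbb R^d$, then the boundaries of the $d$-cells are independent, i.e. $\partial:C_d(C;G)\to C_{d-1}(C;G)$ is injective (with $C_{-1}(C;G)=G$), and the statistics is trivial: $T(m_{d-1}(C,f))=0$. 2. If $-1\le p<d-1$, the lattice models of $p$-dimensional excitations in $\mathbb R^d$ and in $S^d$, and their statistics, are the same: (a) for every embedding $f$ of the $(p+1)$-skeleton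 of $C$ in $\mathbb R^d$ there are a point $y\in S^d$ and a homeomorphism $j:\mathbb R^d\to S^d\setminus\{y\}$ such that $j\circ f$ is an embedding in $S^d$; (b) every embedding $g$ of the $(p+1)$-skeleton of $C$ in $S^d$ has the form $g=j\circ f$ for a point $y\in S^d$, a homeomorphism $j:\mathbb R^d\to S^d\setminus\{y\}$ and an embedding $f$ of the $(p+1)$-skeleton in $\mathbb R^d$; (c) for all embeddings $f$ in $\mathbb R^d$ and $g$ in $S^d$ of the $(p+1)$-skeleton, the identity of expressions maps $E_{\rm inv}(m_p(C,f))$ into $E_{\rm inv}(m_p(C,g))$ and induces an isomorphism $T(m_p(C,f))\cong T(m_p(C,g))$. -/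

import Mathlib

open Topology

noncomputable section

namespace ExcitationStatistics

universe u v w

/-! ### Excitation models -/

/-- An excitation model in a space `M`: an abelian group `A` of configurations, a set `S` of moving
operators, a map `bd : S → A` whose image generates `A`, and a support in `M` for every moving
operator. -/
structure ExcitationModel (M : Type w) where
  /-- The configurations. -/
  A : Type u
  [addCommGroup : AddCommGroup A]
  /-- The moving operators. -/
  S : Type v
  /-- The configuration created by a moving operator. -/
  bd : S → A
  generates : AddSubgroup.closure (Set.range bd) = ⊤
  supp : S → Set M

attribute [instance] ExcitationModel.addCommGroup

namespace ExcitationModel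

variable {M : Type w} (m : ExcitationModel.{u, v, w} M)

/-- The expression group `E(m)`, free abelian on the symbols `θ(s, a)`. -/
abbrev Expr : Type max u v := (m.S × m.A) →₀ ℤ

/-- The extension of `bd` to the free group `F(S)` of processes. -/
def bdProc (g : FreeGroup m.S) : m.A :=
  (FreeGroup.lift (fun s => Multiplicative.ofAdd (m.bd s)) g).toAdd

/-- The moving operator `s` acting on pairs (configuration, accumulated phase):
`(a, e) ↦ (a + ∂s, e + θ(s, a))`. -/
def step (s : m.S) : Equiv.Perm (m.A × m.Expr) where
  toFun x := (x.1 + m.bd s, x.2 + Finsupp.single (s, x.1) 1)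
  invFun x := (x.1 - m.bd s, x.2 - Finsupp.single (s, x.1 - m.bd s) 1)
  left_inv x := by ext1 <;> simp
  right_inv x := by ext1 <;> simp

/-- The action of a process on pairs (configuration, accumulated phase); the rightmost letter acts
first. -/
def run : FreeGroup m.S →* Equiv.Perm (m.A × m.Expr) := FreeGroup.lift m.step

/-- `θ(g, a)`: the phase accumulated by the process `g` started in the configuration `a`. -/
def theta (g : FreeGroup m.S) (a : m.A) : m.Expr := (m.run g (a, 0)).2

theorem bdProc_mul (g h : FreeGroup m.S) : m.bdProc (g * h) = m.bdProc g + m.bdProc h := by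
  simp [bdProc]

theorem run_apply (g : FreeGroup m.S) :
    ∀ (a : m.A) (e : m.Expr), m.run g (a, e) = (a + m.bdProc g, e + m.theta g a) := by
  induction g using FreeGroup.induction_on with
  | C1 => intro a e; simp [bdProc, theta]
  | of s => intro a e; simp [run, bdProc, theta, step]
  | inv_of s _ =>
    intro a e
    simp [run, bdProc, theta, step, Equiv.Perm.inv_def, sub_eq_add_neg]
  | mul g h hg hh =>
    intro a e
    have h1 : m.theta (g * h) a = m.theta h a + m.theta g (a + m.bdProc h) := by
      have : m.run (g * h) (a, 0) = m.run g (m.run h (a, 0)) := by simp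
      rw [theta, this, hh, hg]; simp
    have : m.run (g * h) (a, e) = m.run g (m.run h (a, e)) := by simp
    rw [this, hh, hg, bdProc_mul, h1]
    ext1
    · simp only; abel
    · simp [add_assoc]

/-- The defining rules of `θ(g, a)`. -/
theorem theta_one (a : m.A) : m.theta 1 a = 0 := by simp [theta]

theorem theta_of (s : m.S) (a : m.A) :
    m.theta (FreeGroup.of s) a = Finsupp.single (s, a) 1 := by simp [theta, run, step]

theorem theta_mul (g h : FreeGroup m.S) (a : m.A) :
    m.theta (g * h) a = m.theta h a + m.theta g (a + m.bdProc h) := by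
  have : m.run (g * h) (a, 0) = m.run g (m.run h (a, 0)) := by simp
  rw [theta, this, run_apply, run_apply]; simp

/-- A set of moving operators is overlapping if their supports have a common point. -/
def Overlapping (V : Set m.S) : Prop := ∃ x : M, ∀ s ∈ V, x ∈ m.supp s

/-- The commutator convention `[a, b] = a⁻¹ b⁻¹ a b`. -/
def comm {F : Type v} [Group F] (a b : F) : F := a⁻¹ * b⁻¹ * a * b

/-- The iterated commutator: the list `[s_k, …, s_2, s_1]` is sent to
`[s_k, [⋯, [s_2, s_1]]]`. -/
def iterComm {S : Type v} : List S → FreeGroup S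
  | [] => 1
  | [s] => FreeGroup.of s
  | s :: t :: l => comm (FreeGroup.of s) (iterComm (t :: l))

/-- The group `E_id` of locality identities, generated by all `θ([s_k, [⋯, [s_2, s_1]]], a)` where
the supports of `s_1, …, s_k` have no common point. -/
def Eid : AddSubgroup m.Expr :=
  AddSubgroup.closure {e | ∃ (l : List m.S) (a : m.A), 2 ≤ l.length ∧
    ¬ m.Overlapping {s | s ∈ l} ∧ e = m.theta (iterComm l) a}

/-- The boundary of an expression, seen as a 1-chain in the graph with vertex set `A` and an edge
from `a` to `a + ∂s` for each `θ(s, a)`. -/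
def chainBd : m.Expr →+ (m.A →₀ ℤ) :=
  Finsupp.liftAddHom fun x =>
    Finsupp.singleAddHom (x.2 + m.bd x.1) - Finsupp.singleAddHom x.2

/-- The subgroup of configurations created by the moving operators outside `V`. -/
def remote (V : Set m.S) : AddSubgroup m.A := AddSubgroup.closure (m.bd '' Vᶜ)

/-- The restriction `q_V` to the expression group of the quotient model `m|_V`:
`θ(s, a) ↦ θ(s, [a])` for `s ∈ V`, and `θ(s, a) ↦ 0` for `s ∉ V`. -/
def restrict (V : Set m.S) : m.Expr →+ ((V × (m.A ⧸ m.remote V)) →₀ ℤ) :=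
  (Finsupp.mapDomain.addMonoidHom
    fun x : {x : m.S × m.A // x.1 ∈ V} =>
      ((⟨x.1.1, x.2⟩ : V), (QuotientAddGroup.mk x.1.2 : m.A ⧸ m.remote V))).comp
    (Finsupp.subtypeDomainAddMonoidHom (p := fun x : m.S × m.A => x.1 ∈ V))

/-- The group `E_inv` of closed expressions whose restriction to every overlapping set of moving
operators vanishes. -/
def Einv : AddSubgroup m.Expr where
  carrier := {e | m.chainBd e = 0 ∧ ∀ V : Set m.S, m.Overlapping V → m.restrict V e = 0}
  zero_mem' := by simp
  add_mem' {a b} ha hb := ⟨by simp [ha.1, hb.1], fun V hV => by simp [ha.2 V hV, hb.2 V hV]⟩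
  neg_mem' {a} ha := ⟨by simp [ha.1], fun V hV => by simp [ha.2 V hV]⟩

/-- The statistics `T(m) = E_inv / E_id`. -/
abbrev Statistics : Type max u v := m.Einv ⧸ m.Eid.addSubgroupOf m.Einv

/-- The class in `T(m)` of an expression in `E_inv`. -/
def statClass (e : m.Einv) : m.Statistics := QuotientAddGroup.mk e

end ExcitationModel

/-! ### Regular cell complexes -/

section Cells

variable {X : Type u} [TopologicalSpace X]

/-- A CW complex is regular if every characteristic map is injective on the closed ball and the
boundary of every cell is a union of closed cells. -/
structure IsRegular (C : Set X) [CWComplex C] : Prop where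
  injOn : ∀ (n : ℕ) (c : RelCWComplex.cell C n),
    Set.InjOn (RelCWComplex.map n c) (Metric.closedBall 0 1)
  frontier : ∀ (n : ℕ) (c : RelCWComplex.cell C n), ∀ x ∈ RelCWComplex.cellFrontier n c,
    ∃ (k : ℕ) (b : RelCWComplex.cell C k), x ∈ RelCWComplex.closedCell k b ∧
      RelCWComplex.closedCell k b ⊆ RelCWComplex.cellFrontier n c

/-- The cells of the augmented complex, indexed by dimension plus one: index `0` is the empty cell
(of dimension `-1`), and index `n + 1` stands for the `n`-cells. -/
def AugCell (C : Set X) [CWComplex C] : ℕ → Type u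
  | 0 => PUnit
  | n + 1 => RelCWComplex.cell C n

/-- The closed cell (the empty set for the empty cell). -/
def AugCell.closed {C : Set X} [CWComplex C] : {n : ℕ} → AugCell C n → Set X
  | 0, _ => ∅
  | n + 1, c => RelCWComplex.closedCell (C := C) n (c : RelCWComplex.cell C n)

/-- An orientation of the cells of a regular cell complex, given by its incidence numbers in the
usual sense: `inc n c b` is the coefficient, `1`, `-1` or `0`, of the `(n-1)`-cell `b` in the
boundary of the `n`-cell `c`. It is nonzero exactly when `b` lies on the boundary of `c`, every
vertex is positively oriented, and the boundary of a boundary is zero (for edges this says that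
the two end points occur with opposite signs). Every regular cell complex has such a system of
incidence numbers, and it is unique up to reversing the orientation of cells of positive
dimension. -/
structure CellOrientation (C : Set X) [CWComplex C] where
  inc : ∀ n : ℕ, RelCWComplex.cell C n → (AugCell C n →₀ ℤ)
  inc_vertex : ∀ (c : RelCWComplex.cell C 0) (b : AugCell C 0), inc 0 c b = 1
  inc_eq : ∀ (n : ℕ) (c : RelCWComplex.cell C n) (b : AugCell C n),
    inc n c b = 0 ∨ inc n c b = 1 ∨ inc n c b = -1
  inc_ne_zero_iff : ∀ (n : ℕ) (c : RelCWComplex.cell C n) (b : AugCell C n),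
    inc n c b ≠ 0 ↔ b.closed ⊆ RelCWComplex.cellFrontier n c
  inc_inc : ∀ (n : ℕ) (c : RelCWComplex.cell C (n + 1)) (a : AugCell C n),
    ((inc (n + 1) c).sum fun (b : RelCWComplex.cell C n) (k : ℤ) => k * inc n b a) = 0

variable {C : Set X} [CWComplex C]

/-- The boundary homomorphism `C_q(C; G) → C_{q-1}(C; G)` of the augmented cellular chain complex
(the augmentation `C_0(C; G) → G` for `q = 0`). -/
def cellularBoundary (o : CellOrientation C) (q : ℕ) (G : Type v) [AddCommGroup G] :
    (RelCWComplex.cell C q →₀ G) →+ (AugCell C q →₀ G) :=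
  Finsupp.liftAddHom fun c =>
    { toFun := fun g => (o.inc q c).mapRange (fun n : ℤ => n • g) (zero_smul ℤ g)
      map_zero' := by ext; simp
      map_add' := fun g h => by ext; simp }

/-- The boundary `∂(c, g)` of a `q`-cell with coefficient `g`, in `B_{q-1}(C; G)`. -/
def cellBoundary (o : CellOrientation C) (q : ℕ) (G : Type v) [AddCommGroup G]
    (c : RelCWComplex.cell C q) (g : G) : (cellularBoundary o q G).range :=
  ⟨cellularBoundary o q G (Finsupp.single c g), _, rfl⟩

theorem closure_cellBoundary (o : CellOrientation C) (q : ℕ) {G : Type v} [AddCommGroup G]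
    (G₀ : Set G) (hG₀ : AddSubgroup.closure G₀ = ⊤) :
    AddSubgroup.closure
      (Set.range fun s : RelCWComplex.cell C q × G₀ => cellBoundary o q G s.1 s.2) = ⊤ := by
  rw [eq_top_iff]
  rintro ⟨_, z, rfl⟩ -
  change (cellularBoundary o q G).rangeRestrict z ∈ _
  induction z using Finsupp.induction_linear with
  | zero => rw [map_zero]; exact zero_mem _
  | add f g hf hg => rw [map_add]; exact add_mem hf hg
  | single c g =>
    have hg : g ∈ AddSubgroup.closure G₀ := by rw [hG₀]; trivial
    induction hg using AddSubgroup.closure_induction with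
    | mem x hx => exact AddSubgroup.subset_closure ⟨(c, ⟨x, hx⟩), rfl⟩
    | zero => rw [Finsupp.single_zero, map_zero]; exact zero_mem _
    | add x y _ _ hx hy => rw [Finsupp.single_add, map_add]; exact add_mem hx hy
    | neg x _ hx => rw [Finsupp.single_neg, map_neg]; exact neg_mem hx

/-- The lattice model of `(q-1)`-dimensional excitations with fusion group `G` on the cell complex
`C` in the space `M`, where the `q`-skeleton of `C` is placed in `M` by `f`: the configurations
are `B_{q-1}(C; G)`, the moving operators are the pairs of a `q`-cell and an element of the
generating subset `G₀`, with the cellular boundary, supported on the image of the closed cell. -/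
def latticeModel [T2Space X] (o : CellOrientation C) (q : ℕ) {G : Type v} [AddCommGroup G] (G₀ : Set G)
    (hG₀ : AddSubgroup.closure G₀ = ⊤) {M : Type w} (f : RelCWComplex.skeleton C q → M) :
    ExcitationModel M where
  A := (cellularBoundary o q G).range
  S := RelCWComplex.cell C q × G₀
  bd s := cellBoundary o q G s.1 s.2
  generates := closure_cellBoundary o q G₀ hG₀
  supp s := f '' {x | (x : X) ∈ RelCWComplex.closedCell q s.1}

end Cells

/-- Euclidean space `ℝ^d`. -/
abbrev Euc (d : ℕ) : Type := EuclideanSpace ℝ (Fin d)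

/-- The unit sphere `S^d` in `ℝ^(d+1)`. -/
abbrev Sph (d : ℕ) : Type := Metric.sphere (0 : Euc (d + 1)) 1

end ExcitationStatistics

end

open ExcitationStatistics

open ExcitationStatistics

/-! Throughout, `q = p + 1`. Part 1 splits into a topological and an algebraic half.

Topology. For d > 0 let z be a nonzero chain of top cells with zero boundary, and let Y be the union
of the images of the cells in its support. Incidence numbers are 0 or ±1, so no facet coefficient
cancels by itself: each facet of a cell in the support belongs to a second such cell. By invariance
of domain the points of open cells, and of open facets shared by two cells, are interior to Y, so
the frontier of Y lies in cells of codimension at least two. A compact set with such a frontier is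
covered by these cells (`subset_of_frontier_subset_of_codim_two`), but Y contains the centres of top
cells. Both topological inputs rest on one fact, proved by computing a volume: a continuous self-map
that is the identity off a ball has a zero.

Algebra. If the boundaries are independent, configurations and expressions project to every set of
cells (`CellDecomposition`). The phase of an iterated commutator is, up to sign, an iterated
difference of d_{∂s} θ(t, a) - d_{∂t} θ(s, a), where d_b is translation by b minus the identity.
Modulo these relations, a cone operator applied to the boundary reproduces every term θ(s, b) that
has been differenced once in each cell other than that of s, over a set of cells without common
point (`exists_contraction`). So closed combinations of such terms are locality identities.
Inclusion-exclusion over the cells reduces an arbitrary invariant expression to these and to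
projections on fewer cells, which are handled by induction.

Part 2. Supports enter the statistics only through the relation of overlapping, which an injective
placement in a nonempty space does not affect. By Baire and invariance of dimension a complex of
dimension less than d cannot fill the sphere, so stereographic projection from a missed point
applies. -/

namespace ExcitationStatistics

open MeasureTheory Set Filter Metric
open scoped NNReal

/-! ### Brouwer's theorem by volume computation. -/

section Brouwer

variable {E : Type*} [NormedAddCommGroup E] [NormedSpace ℝ E] [FiniteDimensional ℝ E]

/-- The segment from 1 to 1 + A consists of invertible operators by the Neumann series, so the
determinant keeps the sign it has at 1. -/
theorem det_one_add_pos (A : E →L[ℝ] E) (hA : ‖A‖ < 1) : 0 < (1 + A).det := by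
  have hne : ∀ s ∈ Icc (0 : ℝ) 1, (1 + s • A).det ≠ 0 := by
    intro s hs
    have hn : ‖-(s • A)‖ < 1 := by
      rw [norm_neg, norm_smul, Real.norm_of_nonneg hs.1]
      nlinarith [hs.2, norm_nonneg A, mul_le_mul_of_nonneg_right hs.2 (norm_nonneg A)]
    have hu : IsUnit (1 + s • A) := by simpa using isUnit_one_sub_of_norm_lt_one hn
    have h1 : IsUnit ((1 + s • A : E →L[ℝ] E) : E →ₗ[ℝ] E) :=
      hu.map (ContinuousLinearMap.toLinearMapRingHom (R₁ := ℝ) (M₁ := E))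
    exact (LinearMap.isUnit_iff_isUnit_det _).1 h1 |>.ne_zero
  have hc : ContinuousOn (fun s : ℝ => (1 + s • A).det) (Icc 0 1) :=
    (ContinuousLinearMap.continuous_det.comp (by fun_prop)).continuousOn
  by_contra hneg
  have h0 : (1 + (0 : ℝ) • A).det = 1 := by
    simp [ContinuousLinearMap.det]
  have := intermediate_value_Icc' (zero_le_one) hc
  obtain ⟨s, hs, h⟩ := this ⟨by simpa using not_lt.1 hneg, by rw [h0]; exact zero_le_one⟩
  exact hne s hs h

theorem exists_polynomial_eval_eq_det (A : E →L[ℝ] E) :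
    ∃ p : Polynomial ℝ, p.natDegree ≤ Module.finrank ℝ E ∧ ∀ t : ℝ, p.eval t = (1 + t • A).det := by
  classical
  let b := Module.finBasis ℝ E
  let M := LinearMap.toMatrix b b (A : E →ₗ[ℝ] E)
  refine ⟨((Polynomial.X : Polynomial ℝ) • M.map Polynomial.C +
    (1 : Matrix _ _ ℝ).map Polynomial.C).det, ?_, fun t => ?_⟩
  · simpa using Polynomial.natDegree_det_X_add_C_le M 1
  · rw [ContinuousLinearMap.det, ← LinearMap.det_toMatrix b, ← Polynomial.coe_evalRingHom,
      RingHom.map_det]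
    congr 1
    ext i j
    have : LinearMap.toMatrix b b ((1 + t • A : E →L[ℝ] E) : E →ₗ[ℝ] E) = 1 + t • M := by
      have : ((1 + t • A : E →L[ℝ] E) : E →ₗ[ℝ] E) = LinearMap.id + t • (A : E →ₗ[ℝ] E) := by
        ext; simp
      rw [this, map_add, map_smul, LinearMap.toMatrix_id]
    rw [this]
    simp only [RingHom.mapMatrix_apply, Matrix.map_apply, Matrix.add_apply, Matrix.smul_apply,
      Matrix.one_apply, smul_eq_mul, Polynomial.coe_evalRingHom, Polynomial.eval_add,
      Polynomial.eval_mul, Polynomial.eval_X, Polynomial.eval_C]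
    split_ifs <;> ring

/-- Lagrange weights at nodes in [0, δ]. They do not depend on the polynomial, so one linear
combination extrapolates a whole family from small t to t = 1 and can be taken out of an integral.
-/
theorem exists_extrapolation_weights (n : ℕ) {δ : ℝ} (hδ : 0 < δ) :
    ∃ (c t : Fin (n + 1) → ℝ), (∀ i, t i ∈ Icc 0 δ) ∧ ∑ i, c i = 1 ∧
      ∀ p : Polynomial ℝ, p.natDegree ≤ n → ∑ i, c i * p.eval (t i) = p.eval 1 := by
  let t : Fin (n + 1) → ℝ := fun i => δ * ((i : ℕ) / (n + 1))
  have hn : (0 : ℝ) < n + 1 := by positivity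
  have ht : Function.Injective t := by
    intro i j h
    simp only [t] at h
    field_simp at h
    exact Fin.ext (by exact_mod_cast h)
  refine ⟨fun i => (Lagrange.basis Finset.univ t i).eval 1, t, fun i => ⟨by positivity, ?_⟩, ?_, ?_⟩
  · have : ((i : ℕ) : ℝ) / (n + 1) ≤ 1 := by
      rw [div_le_one hn]; exact_mod_cast i.2.le
    nlinarith
  · rw [← Polynomial.eval_finsetSum, Lagrange.sum_basis ht.injOn Finset.univ_nonempty]
    simp
  · intro p hp
    have hd : p.degree < (Finset.univ : Finset (Fin (n + 1))).card := by
      rw [Finset.card_univ, Fintype.card_fin]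
      exact lt_of_le_of_lt Polynomial.degree_le_natDegree (by exact_mod_cast Nat.lt_succ_of_le hp)
    conv_rhs => rw [Lagrange.eq_interpolate (s := Finset.univ) ht.injOn hd]
    rw [Lagrange.interpolate_apply, Polynomial.eval_finsetSum]
    simp [mul_comm]

/-- A segment leaving the ball crosses the sphere, where w vanishes, so extending by zero costs
nothing in the Lipschitz constant. -/
theorem lipschitzWith_indicator_closedBall {E : Type*} [NormedAddCommGroup E] [NormedSpace ℝ E]
    {w : E → E} {R : ℝ} {K : ℝ≥0}
    (hK : LipschitzOnWith K w (closedBall 0 R)) (hw : ∀ x, ‖x‖ = R → w x = 0) :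
    LipschitzWith K ((closedBall 0 R).indicator w) := by
  have key : ∀ x ∈ closedBall (0 : E) R, ∀ y ∉ closedBall (0 : E) R,
      ‖w x‖ ≤ K * ‖x - y‖ := by
    intro x hx y hy
    have hc : ContinuousOn (fun s : ℝ => ‖x + s • (y - x)‖) (Icc 0 1) :=
      (by fun_prop : Continuous _).continuousOn
    obtain ⟨s, hs, h⟩ := intermediate_value_Icc zero_le_one hc
      ⟨by simpa using hx, by simpa using (not_le.1 (by simpa using hy)).le⟩
    have h1 := hK.dist_le_mul x hx (x + s • (y - x)) (by simp [h])
    rw [hw _ h, dist_zero_right] at h1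
    refine h1.trans (mul_le_mul_of_nonneg_left ?_ K.2)
    rw [dist_eq_norm, sub_add_cancel_left, norm_neg, norm_smul, Real.norm_of_nonneg hs.1,
      norm_sub_rev]
    nlinarith [hs.2, norm_nonneg (x - y)]
  refine LipschitzWith.of_dist_le_mul fun x y => ?_
  by_cases hx : x ∈ closedBall (0 : E) R <;> by_cases hy : y ∈ closedBall (0 : E) R
  · rw [indicator_of_mem hx, indicator_of_mem hy]; exact hK.dist_le_mul x hx y hy
  · rw [indicator_of_mem hx, indicator_of_notMem hy, dist_zero_right, dist_eq_norm]
    exact key x hx y hy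
  · rw [indicator_of_notMem hx, indicator_of_mem hy, dist_zero_left, dist_eq_norm, norm_sub_rev]
    exact key y hy x hx
  · rw [indicator_of_notMem hx, indicator_of_notMem hy, dist_self]; positivity

/-- The image of a ball under a small radial-boundary-preserving perturbation of the identity is the
ball. -/
theorem bijOn_closedBall_add_smul {w : E → E} {R : ℝ} {K : ℝ≥0}
    (hK : LipschitzOnWith K w (closedBall 0 R)) (hw : ∀ x, ‖x‖ = R → w x = 0)
    (hm : ∀ x, ‖x‖ ≤ R → ‖x + w x‖ ≤ R) {t : ℝ} (ht : 0 ≤ t) (ht1 : t ≤ 1) (htK : t * K < 1) :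
    BijOn (fun x => x + t • w x) (closedBall 0 R) (closedBall 0 R) := by
  lift t to ℝ≥0 using ht
  have ht := t.coe_nonneg
  set v := (closedBall (0 : E) R).indicator w
  have hv : LipschitzWith K v := lipschitzWith_indicator_closedBall hK hw
  have happ : ApproximatesLinearOn (fun x => x + (t : ℝ) • v x)
      ((ContinuousLinearEquiv.refl ℝ E : E ≃L[ℝ] E) : E →L[ℝ] E) univ (t * K) := by
    intro x _ y _
    have : x + (t : ℝ) • v x - (y + (t : ℝ) • v y) - (x - y) = (t : ℝ) • (v x - v y) := by
      rw [smul_sub]; abel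
    simp only [ContinuousLinearEquiv.coe_refl, ContinuousLinearMap.coe_id', id, this, norm_smul,
      Real.norm_of_nonneg ht]
    rw [NNReal.coe_mul, mul_assoc]
    exact mul_le_mul_of_nonneg_left (by simpa [dist_eq_norm] using hv.dist_le_mul x y) ht
  have hN : Subsingleton E ∨ (t * K) <
      ‖((ContinuousLinearEquiv.refl ℝ E).symm : E →L[ℝ] E)‖₊⁻¹ := by
    rcases subsingleton_or_nontrivial E with h | h
    · exact Or.inl h
    · right
      have : ‖((ContinuousLinearEquiv.refl ℝ E).symm : E →L[ℝ] E)‖₊ = 1 := by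
        ext; exact ContinuousLinearMap.norm_id
      rw [this, inv_one]
      exact_mod_cast htK
  have hve : ∀ x ∈ closedBall (0 : E) R, x + (t : ℝ) • v x = x + (t : ℝ) • w x := by
    intro x hx; simp only [v, indicator_of_mem hx]
  refine ⟨fun x hx => ?_, fun x hx y hy h => ?_, fun y hy => ?_⟩
  · rw [mem_closedBall_zero_iff] at hx ⊢
    have : x + (t : ℝ) • w x = (1 - (t : ℝ)) • x + (t : ℝ) • (x + w x) := by
      rw [sub_smul, smul_add, one_smul]; abel
    simp only [this]
    refine (norm_add_le _ _).trans ?_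
    rw [norm_smul, norm_smul, Real.norm_of_nonneg ht, Real.norm_of_nonneg (sub_nonneg.2 ht1)]
    nlinarith [hm x hx]
  · refine happ.injOn hN (mem_univ x) (mem_univ y) ?_
    simpa only [hve x hx, hve y hy] using h
  · obtain ⟨x, hx⟩ := happ.surjective hN y
    by_cases hxB : x ∈ closedBall (0 : E) R
    · exact ⟨x, hxB, by rw [← hx]; exact (hve x hxB).symm⟩
    -- The extended map is the identity off the ball, so a point of the ball has no preimage
    -- outside.
    · have : x = y := by simpa [v, indicator_of_notMem hxB] using hx
      exact absurd (this ▸ hy) hxB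

/-- For small t the map x + t w(x) is a bijection of the ball, and change of variables equates the
integral of its Jacobian with the volume. The Jacobian is a polynomial in t, so the equality
extrapolates to t = 1, where the map need not be injective. -/
theorem integral_det_one_add_fderiv [MeasurableSpace E] [BorelSpace E] (μ : Measure E)
    [μ.IsAddHaarMeasure] {w : E → E} {R : ℝ} (hw : ContDiff ℝ 1 w)
    (hw0 : ∀ x, ‖x‖ = R → w x = 0) (hm : ∀ x, ‖x‖ ≤ R → ‖x + w x‖ ≤ R) :
    ∫ x in closedBall (0 : E) R, (1 + fderiv ℝ w x).det ∂μ = μ.real (closedBall 0 R) := by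
  have hD : Continuous (fderiv ℝ w) := hw.continuous_fderiv one_ne_zero
  obtain ⟨K, hK⟩ : ∃ K : ℝ≥0, ∀ x ∈ closedBall (0 : E) R, ‖fderiv ℝ w x‖₊ ≤ K := by
    obtain ⟨K, hK⟩ := (isCompact_closedBall (0 : E) R).exists_bound_of_continuousOn hD.continuousOn
    exact ⟨K.toNNReal, fun x hx => by
      rw [← NNReal.coe_le_coe]; exact (hK x hx).trans (Real.le_coe_toNNReal K)⟩
  have hL : LipschitzOnWith K w (closedBall 0 R) :=
    (convex_closedBall 0 R).lipschitzOnWith_of_nnnorm_fderiv_le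
      (fun x _ => (hw.differentiable one_ne_zero) x) hK
  set δ : ℝ := 1 / (K + 1) with hδ
  have hδ0 : 0 < δ := by positivity
  have hδ1 : δ ≤ 1 := by rw [hδ, div_le_one (by positivity)]; simp
  have hsmall : ∀ t ∈ Icc 0 δ,
      ∫ x in closedBall (0 : E) R, (1 + t • fderiv ℝ w x).det ∂μ = μ.real (closedBall 0 R) := by
    intro t ht
    have htK : t * K < 1 := by
      have h1 : δ * (K + 1) = 1 := by rw [hδ]; field_simp
      nlinarith [K.coe_nonneg, mul_le_mul_of_nonneg_right ht.2 K.coe_nonneg]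
    have hb := bijOn_closedBall_add_smul hL hw0 hm ht.1 (ht.2.trans hδ1) htK
    have hder : ∀ x ∈ closedBall (0 : E) R, HasFDerivWithinAt (fun x => x + t • w x)
        (1 + t • fderiv ℝ w x) (closedBall 0 R) x := fun x _ =>
      ((hasFDerivAt_id x).add (((hw.differentiable one_ne_zero) x).hasFDerivAt.const_smul
        t)).hasFDerivWithinAt
    have := integral_image_eq_integral_abs_det_fderiv_smul μ measurableSet_closedBall hder hb.injOn
      (fun _ => (1 : ℝ))
    rw [hb.image_eq] at this
    simp only [integral_const, smul_eq_mul, mul_one, measureReal_restrict_apply_univ] at this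
    rw [this]
    refine setIntegral_congr_fun measurableSet_closedBall fun x hx => ?_
    have : 0 < (1 + t • fderiv ℝ w x).det := by
      refine det_one_add_pos _ ?_
      rw [norm_smul, Real.norm_of_nonneg ht.1]
      exact (mul_le_mul_of_nonneg_left (by exact_mod_cast hK x hx) ht.1).trans_lt htK
    simp only [abs_of_pos this]
  obtain ⟨c, t, ht, hc, hp⟩ := exists_extrapolation_weights (Module.finrank ℝ E) hδ0
  have hpt : ∀ x, (1 + fderiv ℝ w x).det = ∑ i, c i * (1 + t i • fderiv ℝ w x).det := by
    intro x
    obtain ⟨p, hpd, hpe⟩ := exists_polynomial_eval_eq_det (fderiv ℝ w x)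
    have := hp p hpd
    simp only [hpe, one_smul] at this
    exact this.symm
  simp only [hpt]
  rw [integral_finsetSum]
  · simp only [integral_const_mul, hsmall _ (ht _), ← Finset.sum_mul, hc, one_mul]
  · intro i _
    refine Integrable.const_mul ?_ _
    refine ContinuousOn.integrableOn_compact (isCompact_closedBall 0 R) ?_
    exact (ContinuousLinearMap.continuous_det.comp (by fun_prop)).continuousOn

end Brouwer

/-- Differentiating ‖N‖² = 1 shows that N x is orthogonal to the range of the derivative, which
would contain N x if the derivative were invertible. -/
theorem det_fderiv_eq_zero_of_norm_eq_one {E : Type*} [NormedAddCommGroup E]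
    [InnerProductSpace ℝ E] [FiniteDimensional ℝ E] {N : E → E} (hN : Differentiable ℝ N)
    (h1 : ∀ x, ‖N x‖ = 1) (x : E) : (fderiv ℝ N x).det = 0 := by
  by_contra hdet
  have hsurj : Function.Surjective (fderiv ℝ N x) := by
    have h : IsUnit (LinearMap.det (fderiv ℝ N x : E →ₗ[ℝ] E)) := (Ne.isUnit hdet)
    have := (LinearMap.isUnit_iff_isUnit_det _).2 h
    exact ((Module.End.isUnit_iff _).1 this).2
  obtain ⟨u, hu⟩ := hsurj (N x)
  have hc : (fun y => inner ℝ (N y) (N y)) = fun _ => (1 : ℝ) := by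
    funext y; rw [real_inner_self_eq_norm_sq, h1]; norm_num
  have h2 := ((hN x).hasFDerivAt.inner ℝ (hN x).hasFDerivAt)
  rw [hc] at h2
  have h3 := h2.unique (hasFDerivAt_const (1 : ℝ) x)
  have h4 := congrArg (fun l : E →L[ℝ] ℝ => l u) h3
  simp [hu, h1] at h4

/-- If F has no zero, normalising a smooth approximation of F gives a map of the ball to its sphere
that fixes the sphere. Its Jacobian vanishes identically, although it should integrate to the volume
of the ball. -/
theorem exists_eq_zero_of_eq_self_off_ball_aux {E : Type*} [NormedAddCommGroup E]
    [InnerProductSpace ℝ E] [FiniteDimensional ℝ E] {F : E → E} (hF : Continuous F) {R : ℝ}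
    (hR : ∀ x, R ≤ ‖x‖ → F x = x) : ∃ x, F x = 0 := by
  rcases subsingleton_or_nontrivial E with hE | hE
  · exact ⟨0, Subsingleton.elim _ _⟩
  wlog hR0 : 0 < R generalizing R
  · exact this (R := 1) (fun x hx => hR x (by linarith)) one_pos
  by_contra! hne
  -- The error bound ‖F x‖ keeps x + g x nonzero; the support condition makes g vanish wherever F is
  -- the identity.
  obtain ⟨g, hg, hgF, hgs⟩ := (hF.sub continuous_id).exists_contDiff_approx 1
    (ε := fun x => ‖F x‖) hF.norm (fun x => norm_pos_iff.2 (hne x))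
  have hg0 : ∀ x, R ≤ ‖x‖ → g x = 0 := by
    intro x hx
    by_contra h
    exact (hgs h) (by simp [hR x hx])
  have hH : ∀ x, x + g x ≠ 0 := by
    intro x h
    have h1 := hgF x
    have h2 : g x - (F x - x) = -F x := by
      rw [eq_neg_of_add_eq_zero_right h]; abel
    rw [dist_eq_norm] at h1
    simp only [Pi.sub_apply, id, h2, norm_neg] at h1
    exact lt_irrefl _ h1
  set N : E → E := fun x => ‖x + g x‖⁻¹ • (x + g x) with hNdef
  have hg' : ContDiff ℝ 1 g := by exact_mod_cast hg
  have hN : ContDiff ℝ 1 N := by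
    have h1 : ContDiff ℝ 1 fun x => x + g x := contDiff_id.add hg'
    exact ((h1.norm ℝ hH).inv fun x => norm_ne_zero_iff.2 (hH x)).smul h1
  have hN1 : ∀ x, ‖N x‖ = 1 := fun x => by
    rw [hNdef, norm_smul, norm_inv, norm_norm, inv_mul_cancel₀ (norm_ne_zero_iff.2 (hH x))]
  let _ : MeasurableSpace E := borel E
  have : BorelSpace E := ⟨rfl⟩
  have hint := integral_det_one_add_fderiv (volume : Measure E) (R := R)
    (w := fun x => R • N x - x) ((contDiff_const.smul hN).sub contDiff_id) (fun x hx => by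
      simp only [hNdef, hg0 x hx.ge, add_zero, hx, smul_inv_smul₀ hR0.ne', sub_self])
    (fun x _ => by
      rw [add_sub_cancel, norm_smul, hN1, mul_one, Real.norm_of_nonneg hR0.le])
  have hz : ∀ x, (1 + fderiv ℝ (fun x => R • N x - x) x).det = 0 := by
    intro x
    have hd := hN.differentiable one_ne_zero
    have : fderiv ℝ (fun x => R • N x - x) x = R • fderiv ℝ N x - 1 :=
      (((hd x).hasFDerivAt.const_smul R).sub (hasFDerivAt_id x)).fderiv
    rw [this, add_sub_cancel, ContinuousLinearMap.det]
    have := det_fderiv_eq_zero_of_norm_eq_one hd hN1 x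
    rw [ContinuousLinearMap.det] at this
    rw [ContinuousLinearMap.toLinearMap_smul, LinearMap.det_smul, this, mul_zero]
  simp only [hz, integral_zero] at hint
  have := (measure_closedBall_pos (volume : Measure E) 0 hR0)
  rw [eq_comm, measureReal_eq_zero_iff (measure_closedBall_lt_top.ne)] at hint
  exact this.ne' hint

/-- A continuous self-map of a finite-dimensional space which is the identity off a ball has a
zero. -/
theorem exists_eq_zero_of_eq_self_off_ball {E : Type*} [NormedAddCommGroup E]
    [NormedSpace ℝ E] [FiniteDimensional ℝ E] {F : E → E} (hF : Continuous F) {R : ℝ}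
    (hR : ∀ x, R ≤ ‖x‖ → F x = x) : ∃ x, F x = 0 := by
  let e := toEuclidean (E := E)
  let e' : E →L[ℝ] EuclideanSpace ℝ (Fin (Module.finrank ℝ E)) := e
  obtain ⟨y, hy⟩ := exists_eq_zero_of_eq_self_off_ball_aux (F := fun y => e (F (e.symm y)))
    (by fun_prop) (R := ‖e'‖ * R) (fun y hy => by
      rcases eq_or_ne y 0 with rfl | hy0
      · by_cases h0 : R ≤ 0
        · rw [map_zero, hR 0 (by simpa using h0), map_zero]
        · have h1 : ‖e'‖ = 0 := by
            have := norm_nonneg e'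
            rw [norm_zero] at hy
            nlinarith
          have : ∀ x, e x = 0 := fun x => by
            have := e'.le_opNorm x
            rw [h1, zero_mul] at this
            exact norm_le_zero_iff.1 this
          exact this _
      · rw [hR _ ?_, e.apply_symm_apply]
        have h1 : ‖y‖ ≤ ‖e'‖ * ‖e.symm y‖ := by
          simpa [e'] using e'.le_opNorm (e.symm y)
        have h2 : 0 < ‖e'‖ := by
          by_contra! h
          have := norm_pos_iff.2 hy0
          nlinarith [norm_nonneg (e.symm y), norm_nonneg e']
        exact le_of_mul_le_mul_left (hy.trans h1) h2)
  exact ⟨_, by simpa using hy⟩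

/-! ### Invariance of domain and of dimension. -/

section InvarianceOfDomain

variable {E F : Type*} [NormedAddCommGroup E] [NormedSpace ℝ E] [FiniteDimensional ℝ E]
  [NormedAddCommGroup F] [NormedSpace ℝ F] [FiniteDimensional ℝ F]

/-- An embedding of a compact subset of a finite-dimensional space has a continuous left inverse. -/
theorem exists_continuousMap_leftInverse {Y : Type*} [TopologicalSpace Y] [T2Space Y]
    [NormalSpace Y] {D : Set E} (hD : IsCompact D) {f : E → Y} (hf : ContinuousOn f D)
    (hi : InjOn f D) : ∃ G : C(Y, E), ∀ x ∈ D, G (f x) = x := by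
  have : CompactSpace D := isCompact_iff_compactSpace.1 hD
  have he : IsClosedEmbedding (D.domRestrict f) :=
    (continuousOn_iff_continuous_domRestrict.1 hf).isClosedEmbedding (injOn_iff_injective.1 hi)
  obtain ⟨G, hG⟩ := ContinuousMap.exists_extension' he (⟨fun x => (x : E), by fun_prop⟩ : C(D, E))
  exact ⟨G, fun x hx => congrFun hG ⟨x, hx⟩⟩

/-- A form of Brouwer's fixed point theorem. -/
theorem exists_eq_zero_of_norm_sub_le {h : E → E} (hc : ContinuousOn h (closedBall 0 1))
    (hh : ∀ x ∈ closedBall (0 : E) 1, ‖x - h x‖ ≤ 1) : ∃ x ∈ closedBall (0 : E) 1, h x = 0 := by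
  let k₀ : C(closedBall (0 : E) 1, closedBall (0 : E) 1) :=
    ⟨fun x => ⟨x - h x, by simpa using hh x x.2⟩, by
      refine Continuous.subtype_mk ?_ _
      exact continuous_subtype_val.sub (continuousOn_iff_continuous_domRestrict.1 hc)⟩
  have : TietzeExtension (closedBall (0 : E) 1) :=
    Metric.instTietzeExtensionClosedBall ℝ (0 : E) one_pos
  obtain ⟨k, hk⟩ := k₀.exists_restrict_eq (isClosed_closedBall (x := (0 : E)) (ε := 1))
  have hk' : ∀ x ∈ closedBall (0 : E) 1, (k x : E) = x - h x := fun x hx =>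
    congrArg Subtype.val (DFunLike.congr_fun hk ⟨x, hx⟩)
  -- The extension k of x - h x is cut off between radii 1 and 2. A zero x equals a multiple of k x
  -- by a factor in [0, 1], hence lies in the unit ball, where the cut-off is 1 and the equation
  -- reads h x = 0.
  obtain ⟨x, hx⟩ := exists_eq_zero_of_eq_self_off_ball
    (F := fun x : E => x - (max 0 (min 1 (2 - ‖x‖))) • (k x : E)) (by fun_prop) (R := 2)
    (fun x hx => by
      have : max 0 (min 1 (2 - ‖x‖)) = 0 := by
        rw [max_eq_left]; exact (min_le_right _ _).trans (by linarith)
      simp [this])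
  have hkn : ‖(k x : E)‖ ≤ 1 := mem_closedBall_zero_iff.1 (k x).2
  have hx1 : ‖x‖ ≤ 1 := by
    rw [sub_eq_zero.1 hx, norm_smul, Real.norm_of_nonneg (le_max_left _ _)]
    exact mul_le_one₀ (max_le zero_le_one (min_le_left _ _)) (norm_nonneg _) hkn
  have hl : max 0 (min 1 (2 - ‖x‖)) = 1 := by
    rw [min_eq_left (by linarith)]; simp
  have hxB : x ∈ closedBall (0 : E) 1 := by simpa using hx1
  rw [hl, one_smul, hk' x hxB, sub_sub_cancel] at hx
  exact ⟨x, hxB, hx⟩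

/-- On K the left inverse G vanishes only at f 0. If f 0 is not interior, some c near it lies
outside K; pushing K away from c and perturbing G slightly removes that zero. The composite with f
stays within distance 1 of the identity of the ball, so it must still have a zero. -/
theorem mem_interior_image_closedBall {f : E → E} (hf : ContinuousOn f (closedBall 0 1))
    (hi : InjOn f (closedBall 0 1)) : f 0 ∈ interior (f '' closedBall 0 1) := by
  set B := closedBall (0 : E) 1 with hB
  have h0B : (0 : E) ∈ B := by simp [hB]
  set K := f '' B with hK
  have hKc : IsCompact K := (isCompact_closedBall (0 : E) 1).image_of_continuousOn hf
  obtain ⟨G, hGf⟩ := exists_continuousMap_leftInverse (isCompact_closedBall (0 : E) 1) hf hi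
  by_contra hp
  obtain ⟨δ, hδ, hGδ⟩ : ∃ δ > 0, ∀ y, ‖y - f 0‖ < 2 * δ → ‖G y‖ ≤ 1 / 10 := by
    have := G.continuous.tendsto (f 0)
    rw [hGf 0 h0B] at this
    obtain ⟨δ, hδ, h⟩ := Metric.tendsto_nhds_nhds.1 this (1 / 10) (by norm_num)
    exact ⟨δ / 2, by positivity, fun y hy => by
      simpa using (h (by rw [dist_eq_norm]; linarith)).le⟩
  obtain ⟨c, hcK, hc⟩ : ∃ c ∉ K, ‖c - f 0‖ < δ := by
    rw [← mem_compl_iff, ← closure_compl] at hp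
    obtain ⟨c, hc, h⟩ := Metric.mem_closure_iff.1 hp δ hδ
    exact ⟨c, hc, by rwa [← dist_eq_norm, dist_comm]⟩
  have hne : ∀ y ∈ K, ‖y - c‖ ≠ 0 := fun y hy h =>
    hcK (by rwa [← sub_eq_zero.1 (norm_eq_zero.1 h)])
  obtain ⟨ε, hε, hε1, hεG⟩ : ∃ ε > 0, ε ≤ 1 / 10 ∧ ∀ y ∈ K, δ ≤ ‖y - c‖ → ε ≤ ‖G y‖ := by
    have hcomp : IsCompact (K ∩ {y | δ ≤ ‖y - c‖}) :=
      hKc.inter_right (isClosed_le continuous_const (by fun_prop))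
    have hpos : ∀ y ∈ K ∩ {y | δ ≤ ‖y - c‖}, 0 < ‖G y‖ := by
      rintro _ ⟨⟨x, hx, rfl⟩, h⟩
      rw [hGf x hx, norm_pos_iff]
      rintro rfl
      rw [mem_ofPred_eq, norm_sub_rev] at h
      linarith
    obtain ⟨ε, hε, h⟩ := hcomp.exists_forall_le' (f := fun y => ‖G y‖)
      (by fun_prop) (a := 0) hpos
    exact ⟨min ε (1 / 10), by positivity, min_le_right _ _, fun y hy hd =>
      (min_le_left _ _).trans (h y ⟨hy, hd⟩)⟩
  -- P - w is within ε of G and has no zero on the sphere around c: the sphere is null, so is its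
  -- image under the smooth P, and a small w avoids that image.
  obtain ⟨P, hP, hPG, -⟩ := G.continuous.exists_contDiff_approx 1 (ε := fun _ => ε / 2)
    continuous_const (fun _ => by positivity)
  obtain ⟨w, hw, hwP⟩ : ∃ w : E, ‖w‖ < ε / 2 ∧ w ∉ P '' sphere c δ := by
    let _ : MeasurableSpace E := borel E
    have : BorelSpace E := ⟨rfl⟩
    have hz := Measure.addHaar_sphere_of_ne_zero (Measure.addHaar : Measure E) c hδ.ne'
    have hz2 := addHaar_image_eq_zero_of_differentiableOn_of_addHaar_eq_zero Measure.addHaar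
      ((hP.differentiable (by simp)).differentiableOn (s := sphere c δ)) hz
    by_contra! h
    have : ball (0 : E) (ε / 2) ⊆ P '' sphere c δ := fun w hw => h w (by simpa using hw)
    exact (measure_ball_pos (Measure.addHaar : Measure E) 0 (by positivity)).ne'
      (measure_mono_null this hz2)
  have hPw : ∀ y, ‖P y - w - G y‖ < ε := fun y => by
    have h1 := hPG y
    rw [dist_eq_norm] at h1
    calc ‖P y - w - G y‖ = ‖(P y - G y) - w‖ := by congr 1; abel
      _ ≤ _ := norm_sub_le _ _
      _ < ε := by linarith
  -- Φ pushes the points of K at distance less than δ from c radially onto the sphere of radius δ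
  -- and fixes the others.
  let Φ : E → E := fun y => c + max (δ / ‖y - c‖) 1 • (y - c)
  have hΦ : ContinuousOn Φ K := by
    have : ContinuousOn (fun y => δ / ‖y - c‖) K :=
      continuousOn_const.div (by fun_prop) hne
    fun_prop
  have hΦ1 : ∀ y ∈ K, δ ≤ ‖y - c‖ → Φ y = y := fun y hy h => by
    have : δ / ‖y - c‖ ≤ 1 := div_le_one_of_le₀ h (norm_nonneg _)
    simp [Φ, max_eq_right this]
  have hΦ2 : ∀ y ∈ K, ‖y - c‖ ≤ δ → ‖Φ y - c‖ = δ := fun y hy h => by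
    have h0 := (norm_nonneg (y - c)).lt_of_ne' (hne y hy)
    have : 1 ≤ δ / ‖y - c‖ := (one_le_div h0).2 h
    simp only [Φ, max_eq_left this, add_sub_cancel_left, norm_smul]
    rw [Real.norm_of_nonneg (by positivity), div_mul_cancel₀ _ h0.ne']
  obtain ⟨x, hx, hx0⟩ := exists_eq_zero_of_norm_sub_le (h := fun x => P (Φ (f x)) - w)
    ((hP.continuous.comp_continuousOn (hΦ.comp hf (mapsTo_image f B))).sub continuousOn_const)
    (fun x hx => by
      have hfx : f x ∈ K := mem_image_of_mem f hx
      rcases le_total δ ‖f x - c‖ with h | h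
      · simp only [hΦ1 _ hfx h]
        have := hPw (f x)
        rw [hGf x hx, norm_sub_rev] at this
        linarith
      · have h1 : ‖x‖ ≤ 1 / 10 := by
          have := hGδ (f x) ((norm_sub_le_norm_sub_add_norm_sub _ c _).trans_lt (by linarith))
          rwa [hGf x hx] at this
        have h2 := hGδ (Φ (f x)) ((norm_sub_le_norm_sub_add_norm_sub _ c _).trans_lt (by
          rw [hΦ2 _ hfx h]; linarith))
        have h3 := hPw (Φ (f x))
        have h4 := norm_sub_le x (P (Φ (f x)) - w)
        have h5 := norm_le_norm_add_norm_sub' (P (Φ (f x)) - w) (G (Φ (f x)))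
        linarith)
  have hfx : f x ∈ K := mem_image_of_mem f hx
  rcases le_total δ ‖f x - c‖ with h | h
  · have h1 := hPw (Φ (f x))
    rw [hx0, zero_sub, norm_neg, hΦ1 _ hfx h] at h1
    linarith [hεG _ hfx h]
  · exact hwP ⟨Φ (f x), by simpa [dist_eq_norm] using hΦ2 _ hfx h, sub_eq_zero.1 hx0⟩

/-- **Invariance of domain**. -/
theorem isOpen_image_of_continuousOn_injOn (hEF : Module.finrank ℝ E = Module.finrank ℝ F)
    {U : Set E} (hU : IsOpen U) {f : E → F} (hf : ContinuousOn f U) (hi : InjOn f U) :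
    IsOpen (f '' U) := by
  rw [isOpen_iff_mem_nhds]
  rintro _ ⟨x, hx, rfl⟩
  obtain ⟨r, hr, hrU⟩ := Metric.nhds_basis_closedBall.mem_iff.1 (hU.mem_nhds hx)
  let e : F ≃L[ℝ] E := ContinuousLinearEquiv.ofFinrankEq hEF.symm
  have hmaps : MapsTo (fun z : E => x + r • z) (closedBall 0 1) U := fun z hz => hrU (by
    rw [mem_closedBall_zero_iff] at hz
    rw [mem_closedBall, dist_eq_norm, add_sub_cancel_left, norm_smul, Real.norm_of_nonneg hr.le]
    nlinarith)
  have h := mem_interior_image_closedBall (f := fun z => e (f (x + r • z)))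
    (e.continuous.comp_continuousOn (hf.comp (by fun_prop) hmaps))
    (fun a ha b hb hab => by
      have := hi (hmaps ha) (hmaps hb) (e.injective hab)
      exact smul_right_injective E hr.ne' (add_left_cancel this))
  rw [mem_interior_iff_mem_nhds] at h
  simp only [smul_zero, add_zero] at h
  have h2 := e.continuous.continuousAt.preimage_mem_nhds h
  refine mem_of_superset h2 ?_
  rintro y ⟨z, hz, hzy⟩
  exact ⟨_, hmaps hz, e.injective hzy⟩

/-- **Invariance of dimension**. -/
theorem finrank_le_of_continuousOn_injOn {U : Set E} (hU : IsOpen U) (hne : U.Nonempty)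
    {f : E → F} (hf : ContinuousOn f U) (hi : InjOn f U) :
    Module.finrank ℝ E ≤ Module.finrank ℝ F := by
  by_contra! hlt
  obtain ⟨k, hk⟩ := Nat.exists_eq_add_of_lt hlt
  obtain ⟨x, hx⟩ := hne
  -- Zero coordinates are added until the dimensions agree. The image would then be open although it
  -- lies in F × {0}.
  have hop := isOpen_image_of_continuousOn_injOn (F := F × (Fin (k + 1) → ℝ))
    (by simp [hk]; ring) hU (f := fun x => (f x, 0)) (by fun_prop)
    (fun a ha b hb hab => hi ha hb (congrArg Prod.fst hab))
  have hc : Continuous fun t : ℝ => (f x, fun _ : Fin (k + 1) => t) := by fun_prop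
  have h0 : {(0 : ℝ)} ∈ 𝓝 (0 : ℝ) := by
    refine mem_of_superset ((hop.preimage hc).mem_nhds ⟨x, hx, rfl⟩) ?_
    rintro t ⟨y, hy, h⟩
    exact (congrFun (congrArg Prod.snd h) 0).symm
  have := mem_interior_iff_mem_nhds.2 h0
  rw [interior_singleton] at this
  exact this

end InvarianceOfDomain

/-! ### Compact sets of codimension two do not separate. -/

section Separation

variable {E : Type*} [NormedAddCommGroup E] [NormedSpace ℝ E] [FiniteDimensional ℝ E]

/-- A map can be perturbed so that the image of an embedded compact subset of a space of dimension
at most `dim E - 2` avoids a given line. -/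
theorem exists_perturbation_avoiding_line {n : ℕ} (hn : n + 2 ≤ Module.finrank ℝ E)
    {D : Set (Fin n → ℝ)} (hD : IsCompact D) {e : (Fin n → ℝ) → E} (he : ContinuousOn e D)
    (hi : InjOn e D) (h : C(E, E)) (v : E) {η : ℝ} (hη : 0 < η) :
    ∃ h' : C(E, E), (∀ x, ‖h' x - h x‖ ≤ η) ∧ ∀ x ∈ e '' D, ∀ t : ℝ, h' x ≠ t • v := by
  have : CompactSpace D := isCompact_iff_compactSpace.1 hD
  have hec : Continuous (D.domRestrict e) := continuousOn_iff_continuous_domRestrict.1 he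
  have hemb : IsClosedEmbedding (D.domRestrict e) :=
    hec.isClosedEmbedding (injOn_iff_injective.1 hi)
  obtain ⟨φ, hφ⟩ := ContinuousMap.exists_restrict_eq hD.isClosed
    (h.comp ⟨D.domRestrict e, hec⟩)
  have hφ' : ∀ z ∈ D, φ z = h (e z) := fun z hz => DFunLike.congr_fun hφ ⟨z, hz⟩
  obtain ⟨P, hP, hPφ, -⟩ := φ.continuous.exists_contDiff_approx 1 (ε := fun _ => η / 2)
    continuous_const (fun _ => by positivity)
  -- P - w meets the line only if w has the form P z - t v. These vectors are the C¹ image of a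
  -- space of dimension n + 1 < dim E, so small w outside it exist.
  obtain ⟨w, hwP, hw⟩ : ∃ w : E, w ∉ range (fun p : (Fin n → ℝ) × ℝ => P p.1 - p.2 • v) ∧
      ‖w‖ < η / 2 := by
    have hd : ContDiff ℝ 1 (fun p : (Fin n → ℝ) × ℝ => P p.1 - p.2 • v) := by
      have hP' : ContDiff ℝ 1 P := by exact_mod_cast hP
      exact (hP'.comp contDiff_fst).sub (contDiff_snd.smul contDiff_const)
    have := hd.dense_compl_range_of_finrank_lt_finrank (by simp; omega)
    obtain ⟨w, hw, hw'⟩ := Metric.dense_iff.1 this 0 (η / 2) (by positivity)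
    exact ⟨w, hw', by simpa using hw⟩
  have hball : TietzeExtension (closedBall (0 : E) η) :=
    Metric.instTietzeExtensionClosedBall ℝ (0 : E) hη
  have hbound : ∀ z : D, P z - w - h (e z) ∈ closedBall (0 : E) η := by
    intro z
    rw [mem_closedBall_zero_iff, ← hφ' z z.2]
    have := hPφ z
    rw [dist_eq_norm] at this
    calc ‖P z - w - φ z‖ = ‖(P z - φ z) - w‖ := by congr 1; abel
      _ ≤ _ := norm_sub_le _ _
      _ ≤ η := by linarith
  obtain ⟨u, hu⟩ := ContinuousMap.exists_extension' hemb
    (⟨fun z => ⟨P z - w - h (e z), hbound z⟩, by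
      refine Continuous.subtype_mk ?_ _
      exact ((hP.continuous.comp continuous_subtype_val).sub continuous_const).sub
        (h.continuous.comp hec)⟩ : C(D, closedBall (0 : E) η))
  refine ⟨⟨fun x => h x + u x, by fun_prop⟩, fun x => ?_, ?_⟩
  · simpa using mem_closedBall_zero_iff.1 (u x).2
  · rintro _ ⟨z, hz, rfl⟩ t ht
    have h1 : (u (e z) : E) = P z - w - h (e z) := congrArg Subtype.val (congrFun hu ⟨z, hz⟩)
    simp only [ContinuousMap.coe_mk, h1, add_sub_cancel] at ht
    exact hwP ⟨(z, t), by simp only [← ht]; abel⟩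

/-- The sets are treated one at a time: the image of those already moved is compact and has positive
distance r from the line, so a further perturbation of size at most r does not spoil them. -/
theorem exists_perturbation_avoiding_line_finset {ι : Type*} (s : Finset ι) (n : ι → ℕ)
    (hn : ∀ i ∈ s, n i + 2 ≤ Module.finrank ℝ E) (D : ∀ i, Set (Fin (n i) → ℝ))
    (hD : ∀ i ∈ s, IsCompact (D i)) (e : ∀ i, (Fin (n i) → ℝ) → E)
    (he : ∀ i ∈ s, ContinuousOn (e i) (D i)) (hi : ∀ i ∈ s, InjOn (e i) (D i)) (g : C(E, E))
    (v : E) {η : ℝ} (hη : 0 < η) :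
    ∃ h : C(E, E), (∀ x, ‖h x - g x‖ ≤ η) ∧ ∀ i ∈ s, ∀ x ∈ e i '' D i, ∀ t : ℝ, h x ≠ t • v := by
  classical
  induction s using Finset.induction_on generalizing η with
  | empty => exact ⟨g, fun x => by simpa using hη.le, by simp⟩
  | insert j s hj ih =>
    simp only [Finset.forall_mem_insert] at hn hD he hi
    obtain ⟨h, hg, hs⟩ := ih hn.2 hD.2 he.2 hi.2 (half_pos hη)
    have hK : IsCompact (h '' ⋃ i ∈ s, e i '' D i) :=
      (s.isCompact_biUnion fun i his => (hD.2 i his).image_of_continuousOn (he.2 i his)).image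
        h.continuous
    have hdis : Disjoint (h '' ⋃ i ∈ s, e i '' D i) ((Submodule.span ℝ {v} : Submodule ℝ E) : Set E) := by
      rw [Set.disjoint_left]
      rintro _ ⟨x, hx, rfl⟩ hv
      obtain ⟨i, his, hx⟩ := mem_iUnion₂.1 hx
      obtain ⟨t, ht⟩ := Submodule.mem_span_singleton.1 hv
      exact hs i his x hx t ht.symm
    obtain ⟨r, hr, hrd⟩ := Metric.exists_pos_forall_lt_edist hK
      (Submodule.closed_of_finiteDimensional (Submodule.span ℝ {v})) hdis
    have hr' : (0 : ℝ) < r := hr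
    obtain ⟨h', hh', hav⟩ := exists_perturbation_avoiding_line hn.1 hD.1 he.1 hi.1 h v
      (η := min (η / 2) r) (by positivity)
    refine ⟨h', fun x => ?_, ?_⟩
    · have h1 := hg x
      have h2 := (hh' x).trans (min_le_left _ _)
      exact (norm_sub_le_norm_sub_add_norm_sub _ (h x) _).trans (by linarith)
    · rw [Finset.forall_mem_insert]
      refine ⟨hav, fun i his x hx t ht => ?_⟩
      have h1 := hrd (h x) ⟨x, mem_iUnion₂.2 ⟨i, his, hx⟩, rfl⟩ (t • v)
        (Submodule.mem_span_singleton.2 ⟨t, rfl⟩)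
      have h2 := (hh' x).trans (min_le_right _ _)
      rw [ht, norm_sub_rev, ← dist_eq_norm] at h2
      rw [edist_dist, ← ENNReal.ofReal_coe_nnreal] at h1
      exact absurd (((ENNReal.ofReal_lt_ofReal_iff_of_nonneg hr'.le).1 h1).trans_le h2) (lt_irrefl _)

/-- A map on a compact set which is homotopic to a constant through nowhere zero maps
extends to a nowhere zero map. -/
theorem exists_nonvanishing_extension {E : Type*} [NormedAddCommGroup E] [NormedSpace ℝ E]
    {L : Set E} (hL : IsCompact L) (g h : C(E, E)) (v : E)
    (hv : v ≠ 0) (hg : ∀ x ∈ L, ‖h x - g x‖ < ‖g x‖) (hh : ∀ x ∈ L, ∀ t : ℝ, h x ≠ t • v) :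
    ∃ H : C(E, E), (∀ x, H x ≠ 0) ∧ ∀ x ∈ L, H x = g x := by
  -- J moves linearly from g to h during [0, 1] and from h to v during [1, 2]. On L the first leg
  -- avoids 0 because h is close to g, the second because h misses the line of v.
  let J : E × ℝ → E := fun p => (1 - min p.2 1) • g p.1 +
    ((min p.2 1 - max (p.2 - 1) 0) • h p.1 + (max (p.2 - 1) 0) • v)
  have hJ : Continuous J := by fun_prop
  have hJL : ∀ x ∈ L, ∀ s ∈ Icc (0 : ℝ) 2, J (x, s) ≠ 0 := by
    intro x hx s hs h0
    rcases le_total s 1 with h1 | h1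
    · have e1 : J (x, s) = g x + s • (h x - g x) := by
        simp only [J, min_eq_left h1, max_eq_right (sub_nonpos.2 h1), sub_zero, zero_smul,
          add_zero, sub_smul, one_smul, smul_sub]
        abel
      rw [e1, add_eq_zero_iff_eq_neg] at h0
      have h2 := hg x hx
      have h3 : ‖g x‖ ≤ ‖h x - g x‖ := by
        rw [h0, norm_neg, norm_smul, Real.norm_of_nonneg hs.1, ← h0]
        exact mul_le_of_le_one_left (norm_nonneg _) h1
      linarith
    · have e1 : J (x, s) = (2 - s) • h x + (s - 1) • v := by
        simp only [J, min_eq_right h1, max_eq_left (sub_nonneg.2 h1), sub_self, zero_smul,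
          zero_add]
        congr 2; ring
      rw [e1] at h0
      rcases hs.2.eq_or_lt with rfl | h2
      · norm_num at h0; exact hv h0
      · refine hh x hx (-((2 - s)⁻¹ * (s - 1))) ?_
        have h3 : (2 - s) ≠ 0 := by linarith
        rw [neg_smul, mul_smul, ← smul_neg, ← eq_neg_of_add_eq_zero_left h0, inv_smul_smul₀ h3]
  -- Z is closed since the time interval is compact. An Urysohn function, 0 on L and 1 on Z, serves
  -- as the time: over Z the homotopy has already reached v.
  let Z : Set E := Prod.fst '' ({p : E × Icc (0 : ℝ) 2 | J (p.1, p.2) = 0})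
  have hZ : IsClosed Z := by
    refine isClosedMap_fst_of_compactSpace _ ?_
    exact isClosed_eq (by fun_prop) continuous_const
  have hdis : Disjoint L Z := by
    rw [Set.disjoint_left]
    rintro x hx ⟨⟨y, s⟩, hp, rfl⟩
    exact hJL _ hx s s.2 hp
  obtain ⟨l, hl0, hl1, hl⟩ := exists_continuous_zero_one_of_isClosed hL.isClosed hZ hdis
  refine ⟨⟨fun x => J (x, 2 * l x), by fun_prop⟩, fun x h0 => ?_, fun x hx => ?_⟩
  · have hxZ : x ∈ Z := ⟨(x, ⟨2 * l x, by linarith [(hl x).1], by linarith [(hl x).2]⟩), h0, rfl⟩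
    have : J (x, 2 * l x) = v := by
      rw [hl1 hxZ]
      norm_num [J]
    exact hv (this.symm.trans h0)
  · change J (x, 2 * l x) = g x
    rw [hl0 hx]
    norm_num [J]

/-- A compact set whose frontier is covered by finitely many embedded compact sets of codimension at
least two is itself covered by them. -/
theorem subset_of_frontier_subset_of_codim_two (hE : 0 < Module.finrank ℝ E) {Y : Set E}
    (hY : IsCompact Y) {ι : Type*} (s : Finset ι) (n : ι → ℕ)
    (hn : ∀ i ∈ s, n i + 2 ≤ Module.finrank ℝ E) (D : ∀ i, Set (Fin (n i) → ℝ))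
    (hD : ∀ i ∈ s, IsCompact (D i)) (e : ∀ i, (Fin (n i) → ℝ) → E)
    (he : ∀ i ∈ s, ContinuousOn (e i) (D i)) (hi : ∀ i ∈ s, InjOn (e i) (D i))
    (hfr : frontier Y ⊆ ⋃ i ∈ s, e i '' D i) : Y ⊆ ⋃ i ∈ s, e i '' D i := by
  classical
  intro a haY
  by_contra haL
  set L := ⋃ i ∈ s, e i '' D i
  have hL : IsCompact L :=
    s.isCompact_biUnion fun i his => (hD i his).image_of_continuousOn (he i his)
  let g : C(E, E) := ⟨fun x => x - a, by fun_prop⟩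
  have : Nontrivial E := Module.finrank_pos_iff.1 hE
  obtain ⟨v, hv⟩ := exists_ne (0 : E)
  obtain ⟨η, hη, hηL⟩ := hL.exists_forall_le' (f := fun x => ‖g x‖) (by fun_prop) (a := 0)
    (fun x hx => norm_pos_iff.2 (sub_ne_zero.2 fun h => haL (h ▸ hx)))
  obtain ⟨h, hg, hh⟩ := exists_perturbation_avoiding_line_finset s n hn D hD e he hi g v
    (half_pos hη)
  obtain ⟨H, hH0, hHL⟩ := exists_nonvanishing_extension hL g h v hv
    (fun x hx => (hg x).trans_lt (by linarith [hηL x hx]))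
    (fun x hx => by
      obtain ⟨i, his, hx⟩ := mem_iUnion₂.1 hx
      exact hh i his x hx)
  -- H on Y and x - a off Y agree on the frontier. The glued map has no zero, because the only zero
  -- a of x - a lies in Y; yet up to translation it is the identity off a ball.
  have hcont : Continuous (Y.piecewise H g) :=
    continuous_piecewise (fun x hx => hHL x (hfr hx)) H.continuous.continuousOn
      g.continuous.continuousOn
  obtain ⟨R, hR⟩ := hY.isBounded.subset_ball a
  obtain ⟨z, hz⟩ := exists_eq_zero_of_eq_self_off_ball
    (F := fun z => Y.piecewise H g (z + a)) (by fun_prop) (R := R) (fun z hz => by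
      have : z + a ∉ Y := fun h => by
        have := hR h
        rw [mem_ball, dist_eq_norm, add_sub_cancel_right] at this
        linarith
      simp [piecewise_eq_of_notMem _ _ _ this, g])
  by_cases hzY : z + a ∈ Y
  · exact hH0 _ ((piecewise_eq_of_mem _ _ _ hzY).symm.trans hz)
  · simp only [piecewise_eq_of_notMem _ _ _ hzY, g, ContinuousMap.coe_mk, add_sub_cancel_right] at hz
    exact hzY (by rw [hz, zero_add]; exact haY)

end Separation

/-- If two embedded balls of top dimension have disjoint interiors and share an open piece of their
boundary spheres, then the shared piece lies in the interior of their union. -/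
theorem subset_interior_union_of_common_face {E F : Type*} [NormedAddCommGroup E] [NormedSpace ℝ E]
    [FiniteDimensional ℝ E] [NormedAddCommGroup F] [NormedSpace ℝ F] [FiniteDimensional ℝ F]
    (hEF : Module.finrank ℝ E = Module.finrank ℝ F) {g₁ g₂ : E → F}
    (hc₁ : ContinuousOn g₁ (closedBall 0 1)) (hi₁ : InjOn g₁ (closedBall 0 1))
    (hc₂ : ContinuousOn g₂ (closedBall 0 1)) (hi₂ : InjOn g₂ (closedBall 0 1)) {b : Set F}
    (hb₁ : b ⊆ g₁ '' sphere 0 1) (hb₂ : b ⊆ g₂ '' sphere 0 1)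
    (hbo : ∃ V : Set E, IsOpen V ∧ V ∩ sphere 0 1 = sphere 0 1 ∩ g₁ ⁻¹' b)
    (hdis : Disjoint (g₁ '' closedBall 0 1) (g₂ '' ball 0 1)) :
    b ⊆ interior (g₁ '' closedBall 0 1 ∪ g₂ '' closedBall 0 1) := by
  classical
  obtain ⟨V, hV, hVb⟩ := hbo
  obtain ⟨G, hG⟩ := exists_continuousMap_leftInverse (isCompact_closedBall (0 : E) 1) hc₂ hi₂
  have hGs : ∀ y ∈ b, ‖G y‖ = 1 ∧ g₂ (G y) = y := by
    intro y hy
    obtain ⟨z, hz, rfl⟩ := hb₂ hy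
    rw [hG z (sphere_subset_closedBall hz)]
    exact ⟨mem_sphere_zero_iff_norm.1 hz, rfl⟩
  let u : E → E := fun x => ‖x‖⁻¹ • x
  have hu : ContinuousOn u {0}ᶜ := by
    refine ContinuousOn.smul (ContinuousOn.inv₀ (by fun_prop) ?_) continuousOn_id
    exact fun x hx => norm_ne_zero_iff.2 hx
  have hu1 : ∀ x, x ≠ 0 → ‖u x‖ = 1 := fun x hx => norm_smul_inv_norm (𝕜 := ℝ) hx
  let N : Set E := ball 0 2 ∩ ({0}ᶜ ∩ u ⁻¹' V)
  have hN : IsOpen N := isOpen_ball.inter (hu.isOpen_inter_preimage isOpen_compl_singleton hV)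
  have hNu : ∀ x ∈ N, u x ∈ sphere (0 : E) 1 ∧ g₁ (u x) ∈ b := by
    intro x hx
    have h1 : u x ∈ sphere (0 : E) 1 := by simpa using hu1 x hx.2.1
    have : u x ∈ sphere (0 : E) 1 ∩ g₁ ⁻¹' b := hVb ▸ ⟨hx.2.2, h1⟩
    exact this
  have hNnorm : ∀ x ∈ N, 0 < 2 - ‖x‖ := fun x hx => by
    have := hx.1
    rw [mem_ball_zero_iff] at this
    linarith
  -- N is an open cone over the face. ψ reflects its outer half in the unit sphere and passes to the
  -- coordinates of the second ball, so that g₁ inside and g₂ ∘ ψ outside agree on the face and glue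
  -- to an injective map Ψ.
  let ψ : E → E := fun x => (2 - ‖x‖) • G (g₁ (u x))
  have hψn : ∀ x ∈ N, ‖ψ x‖ = 2 - ‖x‖ := fun x hx => by
    rw [norm_smul, (hGs _ (hNu x hx).2).1, mul_one, Real.norm_of_nonneg (hNnorm x hx).le]
  have hψB : ∀ x ∈ N, 1 ≤ ‖x‖ → ψ x ∈ closedBall (0 : E) 1 := fun x hx h => by
    rw [mem_closedBall_zero_iff, hψn x hx]; linarith
  have hψb : ∀ x ∈ N, 1 < ‖x‖ → ψ x ∈ ball (0 : E) 1 := fun x hx h => by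
    rw [mem_ball_zero_iff, hψn x hx]; linarith
  let Ψ : E → F := fun x => if ‖x‖ ≤ 1 then g₁ x else g₂ (ψ x)
  have hΨ : ContinuousOn Ψ N := by
    refine ContinuousOn.if ?_ ?_ ?_
    · rintro x ⟨hxN, hx⟩
      have h1 : ‖x‖ = 1 := frontier_le_subset_eq continuous_norm continuous_const hx
      have hux : u x = x := by simp [u, h1]
      have h2 := (hNu x hxN).2
      have h3 : ψ x = G (g₁ x) := by simp only [ψ, h1, hux]; norm_num
      rw [hux] at h2
      rw [h3, (hGs _ h2).2]
    · refine hc₁.mono ?_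
      rintro x ⟨-, hx⟩
      rw [(isClosed_le continuous_norm continuous_const).closure_eq] at hx
      simpa using hx
    · have hψ : ContinuousOn ψ N := by
        refine ContinuousOn.smul (by fun_prop) ?_
        refine G.continuous.comp_continuousOn ?_
        exact hc₁.comp (hu.mono fun x hx => hx.2.1) fun x hx =>
          sphere_subset_closedBall (hNu x hx).1
      refine hc₂.comp (hψ.mono inter_subset_left) ?_
      rintro x ⟨hxN, hx⟩
      refine hψB x hxN ?_
      have : {a : E | ¬ ‖a‖ ≤ 1} = {a | 1 < ‖a‖} := by ext; simp
      rw [this] at hx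
      exact closure_lt_subset_le continuous_const continuous_norm hx
  have hψi : ∀ x ∈ N, ∀ y ∈ N, ψ x = ψ y → x = y := by
    intro x hx y hy h
    have hn : ‖x‖ = ‖y‖ := by
      have := congrArg norm h
      rw [hψn x hx, hψn y hy] at this
      linarith
    have h1 : G (g₁ (u x)) = G (g₁ (u y)) := by
      simp only [ψ, hn] at h
      exact smul_right_injective E (hNnorm y hy).ne' h
    have h2 : u x = u y := by
      refine hi₁ (sphere_subset_closedBall (hNu x hx).1) (sphere_subset_closedBall (hNu y hy).1) ?_
      rw [← (hGs _ (hNu x hx).2).2, h1, (hGs _ (hNu y hy).2).2]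
    simp only [u, hn] at h2
    exact smul_right_injective E (inv_ne_zero (norm_ne_zero_iff.2 hy.2.1)) h2
  have hΨi : InjOn Ψ N := by
    intro x hx y hy h
    simp only [Ψ] at h
    split_ifs at h with h1 h2 h2
    · exact hi₁ (by simpa using h1) (by simpa using h2) h
    · exact (disjoint_left.1 hdis ⟨x, by simpa using h1, rfl⟩
        ⟨ψ y, hψb y hy (not_le.1 h2), h.symm⟩).elim
    · exact (disjoint_left.1 hdis ⟨y, by simpa using h2, rfl⟩
        ⟨ψ x, hψb x hx (not_le.1 h1), h⟩).elim
    · exact hψi x hx y hy (hi₂ (hψB x hx (not_le.1 h1).le) (hψB y hy (not_le.1 h2).le) h)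
  have hop := isOpen_image_of_continuousOn_injOn hEF hN hΨ hΨi
  intro y hy
  obtain ⟨x, hx, rfl⟩ := hb₁ hy
  have hx1 : ‖x‖ = 1 := by simpa using hx
  refine mem_interior.2 ⟨Ψ '' N, ?_, hop, ⟨x, ⟨?_, ?_, ?_⟩, ?_⟩⟩
  · rintro _ ⟨z, hz, rfl⟩
    by_cases h : ‖z‖ ≤ 1
    · exact Or.inl ⟨z, by simpa using h, by simp [Ψ, h]⟩
    · exact Or.inr ⟨ψ z, hψB z hz (not_le.1 h).le, by simp [Ψ, h]⟩
  · simp [hx1]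
  · rintro rfl; simp at hx1
  · have : x ∈ V ∩ sphere 0 1 := by rw [hVb]; exact ⟨hx, hy⟩
    simpa [u, hx1] using this.1
  · simp [Ψ, hx1]

/-! ### Independence of the boundaries of top cells. -/

section Cells

variable {X : Type*} [TopologicalSpace X] {C : Set X} [CWComplex C]

open RelCWComplex

theorem disjoint_closedCell_openCell [T2Space X] {m n : ℕ} (j : cell C m) (b : cell C n) (hmn : m ≤ n)
    (hne : (⟨m, j⟩ : Σ n, cell C n) ≠ ⟨n, b⟩) : Disjoint (closedCell m j) (openCell n b) := by
  rw [← cellFrontier_union_openCell_eq_closedCell, disjoint_union_left]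
  refine ⟨?_, disjoint_openCell_of_ne hne⟩
  exact (disjoint_skeletonLT_openCell (n := m) (by exact_mod_cast hmn)).mono_left
    (cellFrontier_subset_skeletonLT m j)

theorem closedCell_subset_skeleton_of_le [T2Space X] {m n : ℕ} (hmn : m ≤ n) (j : cell C m) :
    closedCell m j ⊆ (skeleton C n : Set X) :=
  (closedCell_subset_skeleton m j).trans (skeleton_mono (by exact_mod_cast hmn))

/-- A facet is open in the boundary of a cell. -/
theorem exists_isOpen_inter_sphere_eq [T2Space X] {n : ℕ} (c : cell C (n + 1)) (b : cell C n) :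
    ∃ V : Set (Fin (n + 1) → ℝ), IsOpen V ∧
      V ∩ sphere 0 1 = sphere 0 1 ∩ map (n + 1) c ⁻¹' openCell n b := by
  classical
  obtain ⟨I, hI⟩ := CWComplex.cellFrontier_subset_finite_closedCell (n + 1) c
  -- Closure finiteness: besides the open cell b, the frontier of c is covered by a closed set K
  -- that misses it, namely the frontier of b and finitely many other closed cells of dimension at
  -- most n.
  let s : Finset (Σ m, cell C m) := ((Finset.range (n + 1)).sigma I).erase ⟨n, b⟩
  let K : Set X := cellFrontier n b ∪ ⋃ i ∈ s, closedCell i.1 i.2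
  have hK : IsClosed K := isClosed_cellFrontier.union
    (s.finite_toSet.isClosed_biUnion fun i _ => isClosed_closedCell)
  have hKb : Disjoint K (openCell n b) := by
    refine disjoint_union_left.2 ⟨?_, disjoint_iUnion₂_left.2 fun i hi => ?_⟩
    · exact (disjoint_skeletonLT_openCell (n := n) le_rfl).mono_left
        (cellFrontier_subset_skeletonLT n b)
    · obtain ⟨hne, hi⟩ := Finset.mem_erase.1 hi
      have := Finset.mem_range.1 (Finset.mem_sigma.1 hi).1
      exact disjoint_closedCell_openCell i.2 b (by omega) hne
  have hcov : cellFrontier (n + 1) c ⊆ K ∪ openCell n b := by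
    intro x hx
    obtain ⟨m, hm, j, hj, hxj⟩ : ∃ m, ∃ _ : m < n + 1, ∃ j, ∃ _ : j ∈ I m, x ∈ closedCell m j := by
      simpa only [mem_iUnion] using hI hx
    by_cases hne : (⟨m, j⟩ : Σ n, cell C n) = ⟨n, b⟩
    · obtain ⟨rfl, h⟩ := Sigma.mk.inj_iff.1 hne
      obtain rfl := eq_of_heq h
      rw [← cellFrontier_union_openCell_eq_closedCell] at hxj
      exact hxj.imp (fun h => Or.inl h) id
    · refine Or.inl (Or.inr (mem_iUnion₂.2 ⟨⟨m, j⟩, ?_, hxj⟩))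
      exact Finset.mem_erase.2 ⟨hne, Finset.mem_sigma.2 ⟨Finset.mem_range.2 hm, hj⟩⟩
  have hcl : IsClosed (sphere 0 1 ∩ map (n + 1) c ⁻¹' K) :=
    ((continuousOn (n + 1) c).mono sphere_subset_closedBall).preimage_isClosed_of_isClosed
      isClosed_sphere hK
  refine ⟨_, hcl.isOpen_compl, ?_⟩
  ext x
  constructor
  · rintro ⟨h1, h2⟩
    refine ⟨h2, (hcov ⟨x, h2, rfl⟩).resolve_left fun h => h1 ⟨h2, h⟩⟩
  · rintro ⟨h1, h2⟩
    exact ⟨fun h => disjoint_left.1 hKb h.2 h2, h1⟩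

/-- Regularity puts x in some closed cell inside the frontier, necessarily of dimension at most n. A
closed cell of such dimension that meets the open cell b can only be b. -/
theorem IsRegular.closedCell_subset_cellFrontier [T2Space X] (hC : IsRegular C) {n : ℕ} (c : cell C (n + 1))
    (b : cell C n) {x : X} (hx : x ∈ cellFrontier (n + 1) c) (hxb : x ∈ openCell n b) :
    closedCell n b ⊆ cellFrontier (n + 1) c := by
  obtain ⟨k, b', hxb', hsub⟩ := hC.frontier (n + 1) c x hx
  have hk : k ≤ n := by
    by_contra! hk
    have h1 : openCell k b' ⊆ (skeletonLT C (n + 1 : ℕ) : Set X) :=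
      (openCell_subset_closedCell k b').trans
        (hsub.trans (cellFrontier_subset_skeletonLT (n + 1) c))
    exact disjoint_left.1 (disjoint_skeletonLT_openCell (n := (n + 1 : ℕ)) (j := b')
      (by exact_mod_cast hk)) (h1 (map_zero_mem_openCell k b')) (map_zero_mem_openCell k b')
  by_cases hne : (⟨k, b'⟩ : Σ n, cell C n) = ⟨n, b⟩
  · obtain ⟨rfl, h⟩ := Sigma.mk.inj_iff.1 hne
    obtain rfl := eq_of_heq h
    exact hsub
  · exact (disjoint_left.1 (disjoint_closedCell_openCell b' b hk hne) hxb' hxb).elim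

theorem cellularBoundary_apply (o : CellOrientation C) (q : ℕ) {G : Type*} [AddCommGroup G]
    (z : cell C q →₀ G) (b : AugCell C q) :
    cellularBoundary o q G z b = z.sum fun c g => o.inc q c b • g := by
  induction z using Finsupp.induction_linear with
  | zero => simp
  | add f g hf hg =>
    rw [map_add, Finsupp.add_apply, hf, hg,
      Finsupp.sum_add_index' (fun _ => smul_zero _) (fun _ _ _ => smul_add _ _ _)]
  | single c g => simp [cellularBoundary]

/-- A lone contribution to the coefficient of b would be ± the nonzero coefficient of c, whatever
the torsion of G. -/
theorem exists_ne_of_cellularBoundary_eq_zero (o : CellOrientation C) {q : ℕ} {G : Type*}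
    [AddCommGroup G] {z : cell C q →₀ G} (hz : cellularBoundary o q G z = 0) {c : cell C q}
    (hc : c ∈ z.support) {b : AugCell C q} (hb : o.inc q c b ≠ 0) :
    ∃ c' ∈ z.support, c' ≠ c ∧ o.inc q c' b ≠ 0 := by
  by_contra! h
  have h1 := cellularBoundary_apply o q z b
  rw [hz, Finsupp.zero_apply, Finsupp.sum, Finset.sum_eq_single_of_mem c hc
    (fun c' hc' hne => by rw [h c' hc' hne, zero_smul])] at h1
  rw [Finsupp.mem_support_iff] at hc
  rcases o.inc_eq q c b with h2 | h2 | h2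
  · exact hb h2
  · exact hc (by simpa [h2] using h1.symm)
  · exact hc (by simpa [h2] using h1.symm)

/-- The top-dimensional cells of a regular complex embedded in Euclidean space of the same positive
dimension carry no cycles. -/
theorem eq_zero_of_cellularBoundary_succ_eq_zero [T2Space X] (hC : IsRegular C)
    (o : CellOrientation C) {n : ℕ} {E : Type*} [NormedAddCommGroup E] [NormedSpace ℝ E]
    [FiniteDimensional ℝ E] (hE : Module.finrank ℝ E = n + 1) {f : X → E}
    (hf : ContinuousOn f (skeleton C (n + 1 : ℕ) : Set X))
    (hi : InjOn f (skeleton C (n + 1 : ℕ) : Set X)) {G : Type*} [AddCommGroup G]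
    {z : cell C (n + 1) →₀ G} (hz : cellularBoundary o (n + 1) G z = 0) : z = 0 := by
  classical
  by_contra hz0
  obtain ⟨c₀, hc₀⟩ := Finsupp.support_nonempty_iff.2 hz0
  have hcell : ∀ {m : ℕ} (_ : m ≤ n + 1) (j : cell C m),
      MapsTo (map m j) (closedBall 0 1) (skeleton C (n + 1 : ℕ) : Set X) := fun hm j x hx =>
    closedCell_subset_skeleton_of_le hm j ⟨x, hx, rfl⟩
  have hfc : ∀ {m : ℕ} (_ : m ≤ n + 1) (j : cell C m),
      ContinuousOn (f ∘ map m j) (closedBall 0 1) := fun hm j =>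
    hf.comp (continuousOn _ j) (hcell hm j)
  have hfi : ∀ {m : ℕ} (_ : m ≤ n + 1) (j : cell C m),
      InjOn (f ∘ map m j) (closedBall 0 1) := fun hm j =>
    hi.comp (hC.injOn _ j) (hcell hm j)
  have hdim : Module.finrank ℝ (Fin (n + 1) → ℝ) = Module.finrank ℝ E := by simp [hE]
  let Y : Set E := ⋃ c ∈ z.support, (f ∘ map (n + 1) c) '' closedBall 0 1
  have hY : IsCompact Y := z.support.isCompact_biUnion fun c _ =>
    (isCompact_closedBall 0 1).image_of_continuousOn (hfc le_rfl c)
  have hsubY : ∀ c ∈ z.support, (f ∘ map (n + 1) c) '' closedBall 0 1 ⊆ Y := fun c hc =>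
    subset_biUnion_of_mem (u := fun c => (f ∘ map (n + 1) c) '' closedBall 0 1) hc
  choose I hI using fun c : cell C (n + 1) =>
    CWComplex.cellFrontier_subset_finite_openCell (n + 1) c
  -- The cells of codimension at least two on the frontiers of the cells in the support.
  let s : Finset (Σ m, cell C m) := z.support.biUnion fun c => (Finset.range n).sigma (I c)
  have hs : ∀ i ∈ s, i.1 < n := fun i hi => by
    obtain ⟨c, -, hi⟩ := Finset.mem_biUnion.1 hi
    exact Finset.mem_range.1 (Finset.mem_sigma.1 hi).1
  have hfr : frontier Y ⊆ ⋃ i ∈ s, (f ∘ map i.1 i.2) '' closedBall 0 1 := by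
    intro y hy
    have hyY : y ∈ Y := hY.isClosed.frontier_subset hy
    have hyi : y ∉ interior Y := hy.2
    obtain ⟨c, hc, x, hx, rfl⟩ := mem_iUnion₂.1 hyY
    rw [← sphere_union_ball] at hx
    rcases hx with hx | hx
    · have hxc : map (n + 1) c x ∈ cellFrontier (n + 1) c := ⟨x, hx, rfl⟩
      obtain ⟨m, hm, j, hj, hxj⟩ : ∃ m, ∃ _ : m < n + 1, ∃ j, ∃ _ : j ∈ I c m,
          map (n + 1) c x ∈ openCell m j := by
        simpa only [mem_iUnion] using hI c hxc
      rcases (Nat.lt_succ_iff_lt_or_eq.1 hm) with hmn | rfl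
      · refine mem_iUnion₂.2 ⟨⟨m, j⟩, Finset.mem_biUnion.2 ⟨c, hc, Finset.mem_sigma.2
          ⟨Finset.mem_range.2 hmn, hj⟩⟩, ?_⟩
        obtain ⟨w, hw, hwx⟩ := hxj
        exact ⟨w, ball_subset_closedBall hw, congrArg f hwx⟩
      · exfalso
        have hjc := hC.closedCell_subset_cellFrontier c j hxc hxj
        obtain ⟨c', hc', hne, hinc⟩ := exists_ne_of_cellularBoundary_eq_zero o hz hc
          (b := j) ((o.inc_ne_zero_iff (m + 1) c j).2 hjc)
        have hjc' : closedCell m j ⊆ cellFrontier (m + 1) c' :=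
          (o.inc_ne_zero_iff (m + 1) c' j).1 hinc
        have hjs : openCell m j ⊆ (skeleton C (m + 1 : ℕ) : Set X) :=
          (openCell_subset_closedCell m j).trans
            (closedCell_subset_skeleton_of_le (Nat.le_succ m) j)
        have hface : ∀ c : cell C (m + 1), closedCell m j ⊆ cellFrontier (m + 1) c →
            f '' openCell m j ⊆ (f ∘ map (m + 1) c) '' sphere 0 1 := by
          intro c h
          rw [image_comp]
          exact image_mono ((openCell_subset_closedCell m j).trans h)
        have key := subset_interior_union_of_common_face hdim (hfc le_rfl c) (hfi le_rfl c)
          (hfc le_rfl c') (hfi le_rfl c') (b := f '' openCell m j) (hface c hjc) (hface c' hjc')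
          (by
            obtain ⟨V, hV, h⟩ := exists_isOpen_inter_sphere_eq c j
            refine ⟨V, hV, h.trans ?_⟩
            ext w
            refine and_congr_right fun hw => ⟨fun h => ⟨_, h, rfl⟩, ?_⟩
            rintro ⟨w', hw', h⟩
            have := hi (hjs hw') (hcell le_rfl c (sphere_subset_closedBall hw)) h
            exact mem_preimage.2 (by rw [← this]; exact hw'))
          (by
            rw [image_comp, image_comp]
            refine disjoint_image_image ?_
            rintro a ha a' ha' h
            have hd := disjoint_closedCell_openCell c c' le_rfl (fun h => hne.symm (by simpa using h))
            have := hi (closedCell_subset_skeleton_of_le le_rfl c ha)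
              (closedCell_subset_skeleton_of_le le_rfl c' (openCell_subset_closedCell _ c' ha')) h
            exact disjoint_left.1 hd ha (this ▸ ha'))
        refine hyi (interior_mono (union_subset (hsubY c hc) (hsubY c' hc')) (key ?_))
        exact ⟨_, hxj, rfl⟩
    · refine (hyi (mem_interior.2 ⟨_, ?_, isOpen_image_of_continuousOn_injOn hdim isOpen_ball
        ((hfc le_rfl c).mono ball_subset_closedBall)
        ((hfi le_rfl c).mono ball_subset_closedBall), ⟨x, hx, rfl⟩⟩)).elim
      exact (image_mono ball_subset_closedBall).trans (hsubY c hc)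
  -- Y would be covered by cells of lower dimension, although the centre of c₀ lies in none of them.
  have hcov := subset_of_frontier_subset_of_codim_two (by omega) hY s (fun i => i.1)
    (fun i hi => by have := hs i hi; omega) (fun i => closedBall 0 1)
    (fun i _ => isCompact_closedBall 0 1) (fun i => f ∘ map i.1 i.2)
    (fun i hi => hfc (by have := hs i hi; omega) i.2)
    (fun i hi => hfi (by have := hs i hi; omega) i.2) hfr
  obtain ⟨i, his, w, hw, h⟩ := mem_iUnion₂.1
    (hcov (hsubY c₀ hc₀ ⟨0, mem_closedBall_self zero_le_one, rfl⟩))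
  have hlt := hs i his
  have := hi (hcell (by omega) i.2 hw) (hcell le_rfl c₀ (mem_closedBall_self zero_le_one)) h
  refine disjoint_left.1 (disjoint_closedCell_openCell i.2 c₀ (by omega) ?_)
    ⟨w, hw, this⟩ (map_zero_mem_openCell _ c₀)
  intro h
  have := congrArg Sigma.fst h
  simp only at this
  omega

/-- The boundaries of the top-dimensional cells of a regular complex embedded in Euclidean space of
the same dimension are independent. -/
theorem cellularBoundary_injective [T2Space X] (hC : IsRegular C) (o : CellOrientation C) {d : ℕ}
    {f : skeleton C d → Euc d} (hf : IsEmbedding f) (G : Type*) [AddCommGroup G] :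
    Function.Injective (cellularBoundary o d G) := by
  rw [injective_iff_map_eq_zero]
  intro z hz
  cases d with
  | zero =>
    by_contra hz0
    obtain ⟨c, hc⟩ := Finsupp.support_nonempty_iff.2 hz0
    let b₀ : AugCell C 0 := PUnit.unit
    -- A cycle for the augmentation needs two vertices, but ℝ⁰ has a single point.
    obtain ⟨c', -, hne, -⟩ := exists_ne_of_cellularBoundary_eq_zero o hz hc (b := b₀)
      (by rw [o.inc_vertex c b₀]; exact one_ne_zero)
    refine hne (injective_map_zero C ?_)
    have h := hf.injective
      (a₁ := ⟨map 0 c' ![], closedCell_subset_skeleton 0 c' ⟨_, by simp, rfl⟩⟩)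
      (a₂ := ⟨map 0 c ![], closedCell_subset_skeleton 0 c ⟨_, by simp, rfl⟩⟩)
      (Subsingleton.elim _ _)
    exact congrArg Subtype.val h
  | succ n =>
    have hext : ∀ x : skeleton C (n + 1 : ℕ),
        Function.extend Subtype.val f 0 (x : X) = f x := fun x =>
      Subtype.val_injective.extend_apply f 0 x
    refine eq_zero_of_cellularBoundary_succ_eq_zero hC o (E := Euc (n + 1)) (by simp)
      (f := Function.extend Subtype.val f 0) ?_ ?_ hz
    · rw [continuousOn_iff_continuous_domRestrict]
      change Continuous fun x : skeleton C (n + 1 : ℕ) => Function.extend Subtype.val f 0 (x : X)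
      simp only [hext]
      exact hf.continuous
    · intro x hx y hy h
      rw [hext ⟨x, hx⟩, hext ⟨y, hy⟩] at h
      exact congrArg Subtype.val (hf.injective h)

end Cells

theorem nonempty_homeomorph_sphere_ne (d : ℕ) (y : Sph d) :
    Nonempty (Euc d ≃ₜ {z : Sph d // z ≠ y}) := by
  have : Fact (Module.finrank ℝ (Euc (d + 1)) = d + 1) := ⟨finrank_euclideanSpace_fin⟩
  let e := (stereographic' d y).toHomeomorphSourceTarget
  have h1 : (stereographic' d y).source = {z | z ≠ y} := by
    rw [stereographic'_source]; rfl
  have h2 : (stereographic' d y).target = univ := stereographic'_target y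
  exact ⟨(Homeomorph.Set.univ (Euc d)).symm.trans
    ((Homeomorph.setCongr h2).symm.trans (e.symm.trans (Homeomorph.setCongr h1)))⟩

/-! ### A complex of lower dimension misses a point of the sphere; independence of the ambient
space. -/

section Cells

variable {X : Type*} [TopologicalSpace X] {C : Set X} [CWComplex C]

open RelCWComplex

/-- Every set of centres meets each open cell in at most one point. As this applies to all subsets
too, the centres form a closed discrete set, which is finite inside a compact skeleton. -/
theorem isClosed_of_subset_cell_centers [T2Space X] {A : Set X}
    (hA : A ⊆ range fun i : Σ m, cell C m => map i.1 i.2 0) : IsClosed A := by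
  have hopen : ∀ (n : ℕ) (j : cell C n), (A ∩ openCell n j).Finite := by
    intro n j
    refine (finite_singleton (map n j 0)).subset ?_
    rintro x ⟨hx, hxj⟩
    obtain ⟨i, rfl⟩ := hA hx
    have := eq_of_not_disjoint_openCell (n := i.1) (j := i.2) (m := n) (i := j)
      (not_disjoint_iff.2 ⟨_, map_zero_mem_openCell i.1 i.2, hxj⟩)
    obtain ⟨m, i⟩ := i
    obtain ⟨rfl, h⟩ := Sigma.mk.inj_iff.1 this
    obtain rfl := eq_of_heq h
    rfl
  have hAC : A ⊆ C := fun x hx => by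
    obtain ⟨i, rfl⟩ := hA hx
    exact openCell_subset_complex i.1 i.2 (map_zero_mem_openCell i.1 i.2)
  exact CWComplex.isClosed_of_isClosed_inter_openCell_or_isClosed_inter_closedCell hAC
    fun n _ j => Or.inl (hopen n j).isClosed

theorem finite_cells_of_isCompact_skeleton [T2Space X] {q : ℕ}
    (hq : IsCompact (skeleton C q : Set X)) : {i : Σ m, cell C m | i.1 ≤ q}.Finite := by
  let z : (Σ m, cell C m) → X := fun i => map i.1 i.2 0
  have hz : Function.Injective z := by
    intro i j h
    have := eq_of_not_disjoint_openCell (n := i.1) (j := i.2) (m := j.1) (i := j.2)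
      (not_disjoint_iff.2 ⟨_, map_zero_mem_openCell i.1 i.2, by
        change z i ∈ _
        rw [h]
        exact map_zero_mem_openCell j.1 j.2⟩)
    exact this
  refine Finite.of_finite_image (f := z) ?_ hz.injOn
  refine IsCompact.finite (hq.of_isClosed_subset ?_ ?_) ⟨?_⟩
  · exact isClosed_of_subset_cell_centers (image_subset_range _ _)
  · rintro _ ⟨i, hi, rfl⟩
    exact closedCell_subset_skeleton_of_le hi i.2 (map_zero_mem_closedCell i.1 i.2)
  · rw [discreteTopology_iff_forall_isClosed]
    intro s
    have : IsClosed (Subtype.val '' s : Set X) := isClosed_of_subset_cell_centers (C := C) (by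
      rintro _ ⟨⟨x, hx⟩, -, rfl⟩
      exact image_subset_range _ _ hx)
    rw [← Subtype.val_injective.preimage_image s]
    exact this.preimage continuous_subtype_val

/-- A regular complex of dimension less than `d` does not fill the sphere `S^d`. -/
theorem exists_notMem_range_of_isEmbedding_sphere [T2Space X] (hC : IsRegular C) {q d : ℕ}
    (hqd : q < d) {g : skeleton C q → Sph d} (hg : IsEmbedding g) : ∃ y, y ∉ range g := by
  by_contra! hsurj
  have : CompactSpace (skeleton C q) :=
    (hg.toHomeomorphOfSurjective hsurj).symm.compactSpace
  have hcomp : IsCompact (skeleton C q : Set X) := isCompact_iff_compactSpace.2 this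
  have hfin := finite_cells_of_isCompact_skeleton hcomp
  have : Finite {i : Σ m, cell C m | i.1 ≤ q} := hfin
  let K : {i : Σ m, cell C m | i.1 ≤ q} → Set (Sph d) := fun i =>
    g '' (Subtype.val ⁻¹' closedCell i.1.1 i.1.2)
  have hK : ∀ i, IsClosed (K i) := fun i =>
    ((isClosed_closedCell.preimage continuous_subtype_val).isCompact.image
      hg.continuous).isClosed
  have hU : ⋃ i, K i = univ := by
    refine eq_univ_of_forall fun y => ?_
    obtain ⟨x, rfl⟩ := hsurj y
    obtain ⟨m, hm, j, hj⟩ := CWComplex.mem_skeleton_iff.1 x.2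
    exact mem_iUnion.2 ⟨⟨⟨m, j⟩, by exact_mod_cast hm⟩, x, openCell_subset_closedCell m j hj, rfl⟩
  have : Nonempty (Sph d) := (NormedSpace.sphere_nonempty.2 zero_le_one).to_subtype
  -- By Baire one of the finitely many closed cells has an image with interior. A left inverse of
  -- its characteristic map then embeds an open subset of ℝ^d in ℝ^m with m ≤ q < d.
  obtain ⟨⟨⟨m, c⟩, hm⟩, p, hp⟩ := nonempty_interior_of_iUnion_of_closed hK hU
  obtain ⟨e⟩ := nonempty_homeomorph_sphere_ne d (-p)
  have hec : Continuous fun x => (e x : Sph d) := continuous_subtype_val.comp e.continuous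
  let U : Set (Euc d) := (fun x => (e x : Sph d)) ⁻¹' interior (K ⟨⟨m, c⟩, hm⟩)
  have hUo : IsOpen U := isOpen_interior.preimage hec
  have hUne : U.Nonempty :=
    ⟨e.symm ⟨p, ne_neg_of_mem_unit_sphere ℝ p⟩, by simpa [U] using hp⟩
  have hmq : ∀ x ∈ closedBall (0 : Fin m → ℝ) 1, map m c x ∈ (skeleton C q : Set X) := fun x hx =>
    closedCell_subset_skeleton_of_le hm c ⟨x, hx, rfl⟩
  classical
  let φ : (Fin m → ℝ) → Sph d := fun x =>
    if h : x ∈ closedBall (0 : Fin m → ℝ) 1 then g ⟨map m c x, hmq x h⟩ else p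
  have hφ : ∀ (x) (h : x ∈ closedBall (0 : Fin m → ℝ) 1), φ x = g ⟨map m c x, hmq x h⟩ :=
    fun x h => dif_pos h
  have hφc : ContinuousOn φ (closedBall 0 1) := by
    rw [continuousOn_iff_continuous_domRestrict]
    have : (closedBall (0 : Fin m → ℝ) 1).domRestrict φ =
        fun x : closedBall (0 : Fin m → ℝ) 1 => g ⟨map m c x, hmq x x.2⟩ := funext fun x => hφ x x.2
    rw [this]
    exact hg.continuous.comp
      ((continuousOn_iff_continuous_domRestrict.1 (continuousOn m c)).subtype_mk _)
  have hφi : InjOn φ (closedBall 0 1) := by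
    intro x hx y hy h
    rw [hφ x hx, hφ y hy] at h
    exact hC.injOn m c hx hy (congrArg Subtype.val (hg.injective h))
  obtain ⟨r, hr⟩ := exists_continuousMap_leftInverse (isCompact_closedBall (0 : Fin m → ℝ) 1)
    hφc hφi
  have hφr : ∀ y ∈ K ⟨⟨m, c⟩, hm⟩, φ (r y) = y := by
    rintro _ ⟨x, ⟨w, hw, hwx⟩, rfl⟩
    have : φ w = g x := by rw [hφ w hw]; congr 1; exact Subtype.ext hwx
    rw [← this, hr w hw]
  have := finrank_le_of_continuousOn_injOn hUo hUne (f := fun x => r (e x))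
    (r.continuous.comp hec).continuousOn (fun x hx y hy h => by
      have h1 := congrArg φ h
      rw [hφr _ (interior_subset hx), hφr _ (interior_subset hy)] at h1
      exact e.injective (Subtype.ext h1))
  simp only [finrank_euclideanSpace_fin, Module.finrank_fin_fun] at this
  have hm' : m ≤ q := hm
  omega

theorem exists_homeomorph_comp_of_isEmbedding_sphere [T2Space X] (hC : IsRegular C) {q d : ℕ}
    (hqd : q < d) {g : skeleton C q → Sph d} (hg : IsEmbedding g) :
    ∃ (y : Sph d) (j : Euc d ≃ₜ {z : Sph d // z ≠ y}) (f : skeleton C q → Euc d),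
      IsEmbedding f ∧ ∀ x, g x = j (f x) := by
  obtain ⟨y, hy⟩ := exists_notMem_range_of_isEmbedding_sphere hC hqd hg
  obtain ⟨j⟩ := nonempty_homeomorph_sphere_ne d y
  have hne : ∀ x, g x ≠ y := fun x h => hy ⟨x, h⟩
  refine ⟨y, j, fun x => j.symm ⟨g x, hne x⟩, ?_, fun x => by simp⟩
  refine j.symm.isEmbedding.comp ?_
  exact IsEmbedding.of_comp (hg.continuous.subtype_mk _) continuous_subtype_val hg

variable [T2Space X]

theorem overlapping_latticeModel_iff (o : CellOrientation C) (q : ℕ) {G : Type*} [AddCommGroup G]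
    (G₀ : Set G) (hG₀ : AddSubgroup.closure G₀ = ⊤) {M : Type*} [Nonempty M]
    {f : skeleton C q → M} (hf : Function.Injective f) (V : Set (cell C q × G₀)) :
    (latticeModel o q G₀ hG₀ f).Overlapping V ↔
      V = ∅ ∨ ∃ x : X, ∀ s ∈ V, x ∈ closedCell q s.1 := by
  constructor
  · rintro ⟨y, hy⟩
    rcases V.eq_empty_or_nonempty with rfl | ⟨s₀, hs₀⟩
    · exact Or.inl rfl
    · obtain ⟨x, -, rfl⟩ := hy s₀ hs₀
      refine Or.inr ⟨x, fun s hs => ?_⟩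
      obtain ⟨x', hx', h⟩ := hy s hs
      exact hf h ▸ hx'
  · rintro (rfl | ⟨x, hx⟩)
    · exact ⟨Classical.arbitrary M, fun s hs => hs.elim⟩
    · rcases V.eq_empty_or_nonempty with rfl | ⟨s₀, hs₀⟩
      · exact ⟨Classical.arbitrary M, fun s hs => hs.elim⟩
      · exact ⟨f ⟨x, closedCell_subset_skeleton q s₀.1 (hx s₀ hs₀)⟩, fun s hs =>
          ⟨_, hx s hs, rfl⟩⟩

/-- The statistics of a lattice model does not depend on the space in which it is embedded. -/
theorem exists_statistics_equiv (o : CellOrientation C) (q : ℕ) {G : Type*} [AddCommGroup G]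
    (G₀ : Set G) (hG₀ : AddSubgroup.closure G₀ = ⊤) {M N : Type*} [Nonempty M] [Nonempty N]
    {f : skeleton C q → M} (hf : Function.Injective f) {g : skeleton C q → N}
    (hg : Function.Injective g) :
    ∃ φ : (latticeModel o q G₀ hG₀ f).Statistics ≃+ (latticeModel o q G₀ hG₀ g).Statistics,
      ∀ (e : (latticeModel o q G₀ hG₀ f).Expr) (he : e ∈ (latticeModel o q G₀ hG₀ f).Einv),
        ∃ he' : e ∈ (latticeModel o q G₀ hG₀ g).Einv,
          φ ((latticeModel o q G₀ hG₀ f).statClass ⟨e, he⟩) =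
            (latticeModel o q G₀ hG₀ g).statClass ⟨e, he'⟩ := by
  -- The two models differ only in their supports, and those occur in `Einv` and `Eid` only through
  -- `Overlapping`.
  have hov : ∀ V : Set (cell C q × G₀), (latticeModel o q G₀ hG₀ f).Overlapping V ↔
      (latticeModel o q G₀ hG₀ g).Overlapping V := fun V =>
    (overlapping_latticeModel_iff o q G₀ hG₀ hf V).trans
      (overlapping_latticeModel_iff o q G₀ hG₀ hg V).symm
  have hinv : (latticeModel o q G₀ hG₀ f).Einv = (latticeModel o q G₀ hG₀ g).Einv := by
    ext e
    exact and_congr Iff.rfl (forall_congr' fun V => imp_congr (hov V) Iff.rfl)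
  have hid : (latticeModel o q G₀ hG₀ f).Eid = (latticeModel o q G₀ hG₀ g).Eid := by
    refine congrArg AddSubgroup.closure ?_
    ext e
    exact exists_congr fun l => exists_congr fun a => and_congr Iff.rfl
      (and_congr (not_congr (hov _)) Iff.rfl)
  let ψ : (latticeModel o q G₀ hG₀ f).Einv ≃+ (latticeModel o q G₀ hG₀ g).Einv :=
    AddEquiv.addSubgroupCongr hinv
  refine ⟨QuotientAddGroup.congr _ _ ψ ?_, fun e he => ⟨hinv ▸ he, rfl⟩⟩
  ext x
  constructor
  · rintro ⟨y, hy, rfl⟩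
    exact hid ▸ hy
  · intro hx
    exact ⟨ψ.symm x, hid ▸ hx, ψ.apply_symm_apply x⟩

end Cells

/-! ### Locality identities as relations between iterated differences. -/

namespace ExcitationModel

universe u v w

variable {M : Type w} (m : ExcitationModel.{u, v, w} M)

/-- The translation `θ(s, a) ↦ θ(s, a + b)`. -/
noncomputable def translate (b : m.A) : m.Expr →+ m.Expr :=
  Finsupp.mapDomain.addMonoidHom fun x => (x.1, x.2 + b)

@[simp]
theorem translate_single (b : m.A) (s : m.S) (a : m.A) (n : ℤ) :
    m.translate b (Finsupp.single (s, a) n) = Finsupp.single (s, a + b) n := by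
  simp [translate]

theorem hom_ext {H : Type*} [AddCommMonoid H] {f g : m.Expr →+ H}
    (h : ∀ s a, f (Finsupp.single (s, a) 1) = g (Finsupp.single (s, a) 1)) : f = g := by
  refine Finsupp.addHom_ext' fun x => ?_
  ext
  exact h x.1 x.2

theorem translate_translate (b b' : m.A) (e : m.Expr) :
    m.translate b (m.translate b' e) = m.translate (b' + b) e := by
  have : (m.translate b).comp (m.translate b') = m.translate (b' + b) :=
    m.hom_ext fun s a => by simp [add_assoc]
  exact DFunLike.congr_fun this e

@[simp]
theorem translate_zero (e : m.Expr) : m.translate 0 e = e := by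
  have : m.translate 0 = AddMonoidHom.id _ := m.hom_ext fun s a => by simp
  exact DFunLike.congr_fun this e

/-- The difference operator of a translation. -/
noncomputable def diff (b : m.A) : m.Expr →+ m.Expr := m.translate b - AddMonoidHom.id _

theorem diff_apply (b : m.A) (e : m.Expr) : m.diff b e = m.translate b e - e := rfl

theorem translate_diff (b b' : m.A) (e : m.Expr) :
    m.translate b (m.diff b' e) = m.diff b' (m.translate b e) := by
  simp only [diff_apply, map_sub, translate_translate, add_comm]

/-- Iterated difference operators. -/
noncomputable def diffs : List m.A → m.Expr →+ m.Expr
  | [] => AddMonoidHom.id _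
  | b :: l => (m.diff b).comp (diffs l)

@[simp]
theorem diffs_nil (e : m.Expr) : m.diffs [] e = e := rfl

@[simp]
theorem diffs_cons (b : m.A) (l : List m.A) (e : m.Expr) :
    m.diffs (b :: l) e = m.diff b (m.diffs l e) := rfl

theorem translate_diffs (b : m.A) (l : List m.A) (e : m.Expr) :
    m.translate b (m.diffs l e) = m.diffs l (m.translate b e) := by
  induction l with
  | nil => rfl
  | cons b' l ih => rw [diffs_cons, translate_diff, ih, diffs_cons]

theorem diff_diffs (b : m.A) (l : List m.A) (e : m.Expr) :
    m.diff b (m.diffs l e) = m.diffs l (m.diff b e) := by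
  rw [diff_apply, translate_diffs, ← map_sub, ← diff_apply]

theorem diffs_append (l l' : List m.A) (e : m.Expr) :
    m.diffs (l ++ l') e = m.diffs l (m.diffs l' e) := by
  induction l with
  | nil => rfl
  | cons b l ih => rw [List.cons_append, diffs_cons, ih, diffs_cons]

theorem bdProc_inv (g : FreeGroup m.S) : m.bdProc g⁻¹ = -m.bdProc g := by simp [bdProc]

theorem bdProc_of (s : m.S) : m.bdProc (FreeGroup.of s) = m.bd s := by simp [bdProc]

theorem theta_inv (g : FreeGroup m.S) (a : m.A) :
    m.theta g⁻¹ a = -m.theta g (a - m.bdProc g) := by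
  have h := m.theta_mul g g⁻¹ a
  rw [mul_inv_cancel, theta_one, bdProc_inv, ← sub_eq_add_neg] at h
  exact eq_neg_of_add_eq_zero_left h.symm

theorem theta_add (g : FreeGroup m.S) :
    ∀ a b, m.theta g (a + b) = m.translate b (m.theta g a) := by
  induction g using FreeGroup.induction_on with
  | C1 => simp [theta_one]
  | of s => simp [theta_of]
  | inv_of s h =>
    intro a b
    rw [theta_inv, theta_inv, map_neg, ← h, sub_add_eq_add_sub]
  | mul g h hg hh =>
    intro a b
    rw [theta_mul, theta_mul, map_add, ← hh, ← hg, add_right_comm]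

theorem bdProc_comm (g h : FreeGroup m.S) : m.bdProc (comm g h) = 0 := by
  simp only [comm, bdProc_mul, bdProc_inv]; abel

/-- A process with zero boundary returns to its start, so conjugation by s merely moves the start by
∂s and the two phases of s cancel. -/
theorem theta_comm (s : m.S) (g : FreeGroup m.S) (hg : m.bdProc g = 0) (a : m.A) :
    m.theta (comm (FreeGroup.of s) g) a = -m.diff (m.bd s) (m.theta g a) := by
  simp only [comm, theta_mul, theta_inv, hg, bdProc_of, diff_apply, ← theta_add, add_zero, sub_zero,
    add_sub_cancel_right, bdProc_inv, neg_zero]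
  abel

theorem theta_comm_of_of (t s : m.S) (a : m.A) :
    m.theta (comm (FreeGroup.of t) (FreeGroup.of s)) a =
      m.diff (m.bd s) (Finsupp.single (t, a) 1) - m.diff (m.bd t) (Finsupp.single (s, a) 1) := by
  simp only [comm, theta_mul, theta_inv, theta_of, bdProc_of, diff_apply, bdProc_inv,
    translate_single]
  have h1 : a + m.bd s + m.bd t - m.bd s = a + m.bd t := by abel
  have h2 : a + m.bd s + m.bd t + -m.bd s - m.bd t = a := by abel
  rw [h1, h2]
  abel

/-- The last two letters t, s form the innermost commutator; each further letter contributes a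
difference operator and a sign. -/
theorem theta_iterComm (l : List m.S) (t s : m.S) (a : m.A) :
    m.bdProc (iterComm (l ++ [t, s])) = 0 ∧
    m.theta (iterComm (l ++ [t, s])) a = (-1 : ℤ) ^ l.length • m.diffs (l.map m.bd)
      (m.diff (m.bd s) (Finsupp.single (t, a) 1) - m.diff (m.bd t) (Finsupp.single (s, a) 1)) := by
  induction l with
  | nil => exact ⟨m.bdProc_comm _ _, by simpa [iterComm] using m.theta_comm_of_of t s a⟩
  | cons r l ih =>
    have h : iterComm (r :: l ++ [t, s]) = comm (FreeGroup.of r) (iterComm (l ++ [t, s])) := by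
      cases l <;> rfl
    rw [h]
    refine ⟨m.bdProc_comm _ _, ?_⟩
    rw [theta_comm _ _ _ ih.1, ih.2, map_zsmul, List.length_cons, pow_succ, mul_neg_one, neg_smul,
      List.map_cons, diffs_cons]

theorem diffs_mem_Eid (l : List m.S) (t s : m.S) (a : m.A)
    (h : ¬ ∃ x, (∀ r ∈ l, x ∈ m.supp r) ∧ x ∈ m.supp t ∧ x ∈ m.supp s) :
    m.diffs (l.map m.bd) (m.diff (m.bd s) (Finsupp.single (t, a) 1) -
      m.diff (m.bd t) (Finsupp.single (s, a) 1)) ∈ m.Eid := by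
  have hgen : m.theta (iterComm (l ++ [t, s])) a ∈ m.Eid := by
    refine AddSubgroup.subset_closure ⟨_, a, by simp, ?_, rfl⟩
    rintro ⟨x, hx⟩
    exact h ⟨x, fun r hr => hx r (by simp [hr]), hx t (by simp), hx s (by simp)⟩
  rw [(m.theta_iterComm l t s a).2] at hgen
  have := zsmul_mem hgen ((-1 : ℤ) ^ l.length)
  rwa [smul_smul, ← mul_pow, neg_one_mul, neg_neg, one_pow, one_smul] at this

theorem chainBd_single (s : m.S) (a : m.A) :
    m.chainBd (Finsupp.single (s, a) 1) =
      Finsupp.single (a + m.bd s) 1 - Finsupp.single a 1 := by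
  simp [chainBd]

/-- The action of the group ring `ℤ[A]` on expressions. -/
noncomputable def act : (m.A →₀ ℤ) →+ m.Expr →+ m.Expr :=
  Finsupp.liftAddHom fun a => zmultiplesHom _ (m.translate a)

@[simp]
theorem act_single (a : m.A) : m.act (Finsupp.single a 1) = m.translate a := by
  simp [act]

/-- A decomposition of the moving operators of a model into independent cells: all moving operators
in a cell have the same support, and the configurations can be projected to any set of cells. -/
structure CellDecomposition (ι : Type*) where
  /-- The cell of a moving operator. -/
  cell : m.S → ι
  /-- The support of a cell. -/
  region : ι → Set M
  supp_eq : ∀ s, m.supp s = region (cell s)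
  /-- The projection of the configurations to a set of cells. -/
  proj : Set ι → m.A →+ m.A
  proj_bd_of_mem : ∀ (U : Set ι) (s : m.S), cell s ∈ U → proj U (m.bd s) = m.bd s
  proj_bd_of_notMem : ∀ (U : Set ι) (s : m.S), cell s ∉ U → proj U (m.bd s) = 0

namespace CellDecomposition

variable {m} {ι : Type*} (D : m.CellDecomposition ι)

theorem addHom_ext {H : Type*} [AddGroup H] {f g : m.A →+ H}
    (h : ∀ s, f (m.bd s) = g (m.bd s)) (a : m.A) : f a = g a := by
  have : f = g := AddMonoidHom.eq_of_eqOn_dense m.generates (by rintro _ ⟨s, rfl⟩; exact h s)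
  rw [this]

theorem proj_proj (U V : Set ι) (a : m.A) : D.proj U (D.proj V a) = D.proj (U ∩ V) a := by
  refine addHom_ext (f := (D.proj U).comp (D.proj V)) (fun s => ?_) a
  by_cases hU : D.cell s ∈ U <;> by_cases hV : D.cell s ∈ V
  · simp [D.proj_bd_of_mem _ s hV, D.proj_bd_of_mem _ s hU, D.proj_bd_of_mem (U ∩ V) s ⟨hU, hV⟩]
  all_goals
    simp [D.proj_bd_of_notMem (U ∩ V) s (fun h => by first | exact hU h.1 | exact hV h.2)]
    first
    | simp [D.proj_bd_of_notMem _ s hV]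
    | simp [D.proj_bd_of_mem _ s hV, D.proj_bd_of_notMem _ s hU]

theorem proj_compl_add_proj (U : Set ι) (a : m.A) : D.proj Uᶜ a + D.proj U a = a := by
  refine addHom_ext (f := D.proj Uᶜ + D.proj U) (g := AddMonoidHom.id _) (fun s => ?_) a
  by_cases hU : D.cell s ∈ U
  · simp [D.proj_bd_of_mem _ s hU, D.proj_bd_of_notMem Uᶜ s (not_not.2 hU)]
  · simp [D.proj_bd_of_notMem _ s hU, D.proj_bd_of_mem Uᶜ s hU]

/-- The configurations created in a cell. -/
def config (i : ι) : AddSubgroup m.A := AddSubgroup.closure (m.bd '' {s | D.cell s = i})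

theorem proj_mem_config (i : ι) (a : m.A) : D.proj {i} a ∈ D.config i := by
  have ha : a ∈ AddSubgroup.closure (range m.bd) := by rw [m.generates]; trivial
  induction ha using AddSubgroup.closure_induction with
  | mem a ha =>
    obtain ⟨s, rfl⟩ := ha
    by_cases h : D.cell s = i
    · rw [D.proj_bd_of_mem {i} s h]
      exact AddSubgroup.subset_closure ⟨s, h, rfl⟩
    · rw [D.proj_bd_of_notMem {i} s h]
      exact zero_mem _
  | zero => rw [map_zero]; exact zero_mem _
  | add a b _ _ ha hb => rw [map_add]; exact add_mem ha hb
  | neg a _ ha => rw [map_neg]; exact neg_mem ha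

theorem proj_of_mem_config {i : ι} {b : m.A} (hb : b ∈ D.config i) {U : Set ι} (hi : i ∈ U) :
    D.proj U b = b := by
  induction hb using AddSubgroup.closure_induction with
  | mem a ha =>
    obtain ⟨s, rfl, rfl⟩ := ha
    exact D.proj_bd_of_mem U s hi
  | zero => rw [map_zero]
  | add a b _ _ ha hb => rw [map_add, ha, hb]
  | neg a _ ha => rw [map_neg, ha]

theorem proj_of_mem_config_of_notMem {i : ι} {b : m.A} (hb : b ∈ D.config i) {U : Set ι}
    (hi : i ∉ U) : D.proj U b = 0 := by
  have h := D.proj_compl_add_proj U b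
  rw [D.proj_of_mem_config hb (show i ∈ Uᶜ from hi)] at h
  simpa using h

/-- Differences along ∂r extend to all configurations of a cell by d_{b+b'} = d_b T_{b'} + d_{b'}
and d_{-b} = -d_b T_{-b}, with T_b the translation by b; the translations are absorbed in the
arbitrary a. -/
theorem diffs_mem_Eid_of_config (P : List (ι × m.A)) (hP : ∀ x ∈ P, x.2 ∈ D.config x.1)
    (l : List m.S) (t s : m.S)
    (h : ¬ ∃ x, (∀ y ∈ P, x ∈ D.region y.1) ∧ (∀ r ∈ l, x ∈ m.supp r) ∧
      x ∈ m.supp t ∧ x ∈ m.supp s) (a : m.A) :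
    m.diffs (l.map m.bd) (m.diffs (P.map Prod.snd)
      (m.diff (m.bd s) (Finsupp.single (t, a) 1) - m.diff (m.bd t) (Finsupp.single (s, a) 1)))
      ∈ m.Eid := by
  induction P generalizing l a with
  | nil => exact m.diffs_mem_Eid l t s a (by simpa using h)
  | cons y P ih =>
    obtain ⟨i, b⟩ := y
    have hb : b ∈ D.config i := hP (i, b) (by simp)
    have hP' : ∀ x ∈ P, x.2 ∈ D.config x.1 := fun x hx => hP x (by simp [hx])
    have htr : ∀ (c a : m.A), m.diff (m.bd s) (Finsupp.single (t, a + c) 1) -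
        m.diff (m.bd t) (Finsupp.single (s, a + c) 1) =
        m.translate c (m.diff (m.bd s) (Finsupp.single (t, a) 1) -
          m.diff (m.bd t) (Finsupp.single (s, a) 1)) := fun c a => by
      simp only [map_sub, translate_diff, translate_single]
    rw [List.map_cons, diffs_cons]
    have h' : ¬ ∃ x, (x ∈ D.region i ∧ ∀ y ∈ P, x ∈ D.region y.1) ∧ (∀ r ∈ l, x ∈ m.supp r) ∧
        x ∈ m.supp t ∧ x ∈ m.supp s := by
      simpa only [List.forall_mem_cons] using h
    clear hP h
    induction hb using AddSubgroup.closure_induction generalizing a with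
    | mem b hb =>
      obtain ⟨r, hr, rfl⟩ := hb
      have hr' : D.cell r = i := hr
      have := ih hP' (l ++ [r]) (by
        rintro ⟨x, hx, hxl, hxts⟩
        refine h' ⟨x, ⟨?_, hx⟩, fun r' hr' => hxl r' (by simp [hr']), hxts⟩
        rw [← hr', ← D.supp_eq]
        exact hxl r (by simp)) a
      rwa [List.map_append, diffs_append] at this
    | zero =>
      rw [diff_apply, translate_zero, sub_self, map_zero]
      exact zero_mem _
    | add b b' _ _ hb hb' =>
      have h1 : ∀ e, m.diff (b + b') e = m.diff b (m.translate b' e) + m.diff b' e := fun e => by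
        simp only [diff_apply, translate_translate, add_comm b b']; abel
      rw [h1, map_add, translate_diffs, ← htr]
      exact add_mem (hb _) (hb' _)
    | neg b _ hb =>
      have h1 : ∀ e, m.diff (-b) e = -m.diff b (m.translate (-b) e) := fun e => by
        simp only [diff_apply, translate_translate, neg_add_cancel, translate_zero]; abel
      rw [h1, map_neg, translate_diffs, ← htr]
      exact neg_mem (hb _)

/-- The expressions supported in a cell. -/
noncomputable def expr (i : ι) : AddSubgroup m.Expr :=
  AddSubgroup.closure {e | ∃ s a, D.cell s = i ∧ e = Finsupp.single (s, a) 1}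

theorem single_mem_expr (s : m.S) (a : m.A) : Finsupp.single (s, a) 1 ∈ D.expr (D.cell s) :=
  AddSubgroup.subset_closure ⟨s, a, rfl, rfl⟩

/-- Modulo the locality identities, the boundary of one expression acts on another
symmetrically. -/
theorem diffs_act_sub_act_mem_Eid (P : List (ι × m.A)) (hP : ∀ x ∈ P, x.2 ∈ D.config x.1)
    {i j : ι} (h : ¬ ∃ x, (∀ y ∈ P, x ∈ D.region y.1) ∧ x ∈ D.region i ∧ x ∈ D.region j)
    {e : m.Expr} (he : e ∈ D.expr i) {e' : m.Expr} (he' : e' ∈ D.expr j) :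
    m.diffs (P.map Prod.snd) (m.act (m.chainBd e') e - m.act (m.chainBd e) e') ∈ m.Eid := by
  induction he using AddSubgroup.closure_induction with
  | mem e he =>
    obtain ⟨s, a, rfl, rfl⟩ := he
    induction he' using AddSubgroup.closure_induction with
    | mem e' he' =>
      obtain ⟨t, b, rfl, rfl⟩ := he'
      -- The claim is biadditive in e and e'. For θ(s, a) and θ(t, b) it is the basic relation at
      -- the configuration a + b.
      have := D.diffs_mem_Eid_of_config P hP [] s t (by simpa [D.supp_eq] using h) (a + b)
      simp only [List.map_nil, diffs_nil, diff_apply, translate_single] at this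
      simp only [chainBd_single, map_sub, AddMonoidHom.sub_apply, act_single, translate_single]
        at this ⊢
      have e1 : a + (b + m.bd t) = a + b + m.bd t := by abel
      have e2 : b + (a + m.bd s) = a + b + m.bd s := by abel
      rw [e1, e2, add_comm b a]
      exact this
    | zero => simp [zero_mem]
    | add x y _ _ hx hy =>
      have := add_mem hx hy
      rw [← map_add] at this
      convert this using 2
      simp only [map_add, AddMonoidHom.add_apply]
      abel
    | neg x _ hx =>
      have := neg_mem hx
      rw [← map_neg] at this
      convert this using 2
      simp only [map_neg, AddMonoidHom.neg_apply]
      abel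
  | zero => simp [zero_mem]
  | add x y _ _ hx hy =>
    have := add_mem hx hy
    rw [← map_add] at this
    convert this using 2
    simp only [map_add, AddMonoidHom.add_apply]
    abel
  | neg x _ hx =>
    have := neg_mem hx
    rw [← map_neg] at this
    convert this using 2
    simp only [map_neg, AddMonoidHom.neg_apply]
    abel

theorem exists_chainBd_eq {i : ι} {b : m.A} (hb : b ∈ D.config i) :
    ∀ a, ∃ y ∈ D.expr i, m.chainBd y = Finsupp.single (a + b) 1 - Finsupp.single a 1 := by
  induction hb using AddSubgroup.closure_induction with
  | mem b hb =>
    obtain ⟨s, rfl, rfl⟩ := hb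
    exact fun a => ⟨_, D.single_mem_expr s a, m.chainBd_single s a⟩
  | zero => exact fun a => ⟨0, zero_mem _, by simp⟩
  | add b b' _ _ hb hb' =>
    intro a
    obtain ⟨y, hy, hya⟩ := hb a
    obtain ⟨y', hy', hya'⟩ := hb' (a + b)
    exact ⟨y + y', add_mem hy hy', by rw [map_add, hya, hya', add_assoc]; abel⟩
  | neg b _ hb =>
    intro a
    obtain ⟨y, hy, hya⟩ := hb (a + -b)
    exact ⟨-y, neg_mem hy, by rw [map_neg, hya, neg_add_cancel_right]; abel⟩

end CellDecomposition

end ExcitationModel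

/-! ### The cone operator and its contraction property. -/

namespace ExcitationModel

universe u v w

variable {M : Type w} {m : ExcitationModel.{u, v, w} M}

namespace CellDecomposition

variable {ι : Type*} (D : m.CellDecomposition ι)

/-- The cone of paths `Θ` in the cell `i`. -/
noncomputable def cone (i : ι) (Θ : m.A → m.Expr) : (m.A →₀ ℤ) →+ m.Expr :=
  Finsupp.liftAddHom fun a =>
    zmultiplesHom _ (m.translate (D.proj {i}ᶜ a) (Θ (D.proj {i} a)))

theorem cone_single (i : ι) (Θ : m.A → m.Expr) (a : m.A) :
    D.cone i Θ (Finsupp.single a 1) = m.translate (D.proj {i}ᶜ a) (Θ (D.proj {i} a)) := by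
  simp [cone]

theorem cone_chainBd_single (i : ι) (Θ : m.A → m.Expr) (s : m.S) (a : m.A) :
    D.cone i Θ (m.chainBd (Finsupp.single (s, a) 1)) =
      m.translate (D.proj {i}ᶜ (a + m.bd s)) (Θ (D.proj {i} (a + m.bd s))) -
        m.translate (D.proj {i}ᶜ a) (Θ (D.proj {i} a)) := by
  rw [chainBd_single, map_sub, cone_single, cone_single]

/-- A configuration of another cell has no component in the cell i, so it does not change the chosen
path and only adds to the outer translation. -/
theorem cone_chainBd_translate (i : ι) (Θ : m.A → m.Expr) {j : ι} (hj : j ≠ i) {b : m.A}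
    (hb : b ∈ D.config j) (e : m.Expr) :
    D.cone i Θ (m.chainBd (m.translate b e)) = m.translate b (D.cone i Θ (m.chainBd e)) := by
  have : ((D.cone i Θ).comp m.chainBd).comp (m.translate b) =
      (m.translate b).comp ((D.cone i Θ).comp m.chainBd) := by
    refine m.hom_ext fun s a => ?_
    have h1 : D.proj {i}ᶜ b = b := D.proj_of_mem_config hb hj
    have h2 : D.proj {i} b = 0 := D.proj_of_mem_config_of_notMem hb hj
    simp only [AddMonoidHom.comp_apply, translate_single, cone_chainBd_single, map_sub,
      translate_translate]
    simp only [map_add, h1, h2, add_zero, add_right_comm _ b]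
  exact DFunLike.congr_fun this e

theorem cone_chainBd_diffs (i : ι) (Θ : m.A → m.Expr) (P : List (ι × m.A))
    (hP : ∀ x ∈ P, x.2 ∈ D.config x.1) (hi : i ∉ P.map Prod.fst) (e : m.Expr) :
    D.cone i Θ (m.chainBd (m.diffs (P.map Prod.snd) e)) =
      m.diffs (P.map Prod.snd) (D.cone i Θ (m.chainBd e)) := by
  induction P with
  | nil => rfl
  | cons x P ih =>
    rw [List.map_cons, List.mem_cons, not_or] at hi
    rw [List.map_cons, diffs_cons, diffs_cons, diff_apply, map_sub, map_sub,
      D.cone_chainBd_translate i Θ (Ne.symm hi.1) (hP x (by simp)),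
      ih (fun y hy => hP y (by simp [hy])) hi.2, ← diff_apply]

/-- The cone operator contracts the expressions which are differences in all cells of a remote
set. -/
theorem exists_contraction (i : ι) : ∃ h : (m.A →₀ ℤ) →+ m.Expr,
    ∀ (P : List (ι × m.A)) (s : m.S) (b : m.A), (∀ x ∈ P, x.2 ∈ D.config x.1) → P ≠ [] →
      (D.cell s :: P.map Prod.fst).Nodup → i ∈ D.cell s :: P.map Prod.fst →
      (¬ ∃ x, (∀ y ∈ P, x ∈ D.region y.1) ∧ x ∈ D.region (D.cell s)) →
      m.diffs (P.map Prod.snd) (Finsupp.single (s, b) 1) -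
        h (m.chainBd (m.diffs (P.map Prod.snd) (Finsupp.single (s, b) 1))) ∈ m.Eid := by
  -- Θ b is a path from 0 to b inside the cell i; its value off the configurations of that cell is
  -- irrelevant.
  have hΘ : ∀ b, ∃ y, b ∈ D.config i → y ∈ D.expr i ∧
      m.chainBd y = Finsupp.single b 1 - Finsupp.single 0 1 := fun b => by
    by_cases hb : b ∈ D.config i
    · obtain ⟨y, hy, hy'⟩ := D.exists_chainBd_eq hb 0
      exact ⟨y, fun _ => ⟨hy, by rwa [zero_add] at hy'⟩⟩
    · exact ⟨0, fun h => (hb h).elim⟩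
  choose Θ hΘ using hΘ
  refine ⟨D.cone i Θ, fun P s b hP hne hnd hi hov => ?_⟩
  rw [List.nodup_cons] at hnd
  set b₀ := D.proj {i}ᶜ b
  set b₁ := D.proj {i} b
  have hb : b₀ + b₁ = b := D.proj_compl_add_proj {i} b
  have hb₁ : b₁ ∈ D.config i := D.proj_mem_config i b
  have hsplit : ∀ (l₁ l₂ : List (ι × m.A)) (y : ι × m.A) (e : m.Expr),
      m.diffs ((l₁ ++ y :: l₂).map Prod.snd) e =
        m.diffs ((l₁ ++ l₂).map Prod.snd) (m.diff y.2 e) := fun l₁ l₂ y e => by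
    rw [List.map_append, List.map_append, diffs_append, diffs_append, List.map_cons, diffs_cons,
      diff_diffs]
  rcases List.mem_cons.1 hi with rfl | hi
  · rw [D.cone_chainBd_diffs _ Θ P hP hnd.1, ← map_sub]
    have hs : m.bd s ∈ D.config (D.cell s) := AddSubgroup.subset_closure ⟨s, rfl, rfl⟩
    -- k is a loop in the cell of s: the edge at b₁ closed up by paths from 0. Its difference along
    -- a configuration of another cell is a locality identity, by symmetry with a path z in that
    -- cell: ∂z acts on k as the translated difference, and ∂k = 0 acts on z as zero.
    set k := Finsupp.single (s, b₁) (1 : ℤ) - Θ (b₁ + m.bd s) + Θ b₁ with hk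
    have hk1 : k ∈ D.expr (D.cell s) :=
      add_mem (sub_mem (D.single_mem_expr s b₁) (hΘ _ (add_mem hb₁ hs)).1) (hΘ _ hb₁).1
    have hk0 : m.chainBd k = 0 := by
      rw [hk, map_add, map_sub, chainBd_single, (hΘ _ (add_mem hb₁ hs)).2, (hΘ _ hb₁).2]
      abel
    have hke : Finsupp.single (s, b) (1 : ℤ) -
        D.cone (D.cell s) Θ (m.chainBd (Finsupp.single (s, b) 1)) = m.translate b₀ k := by
      rw [cone_chainBd_single, map_add, map_add,
        D.proj_bd_of_mem {D.cell s} s rfl, D.proj_bd_of_notMem {D.cell s}ᶜ s (by simp), add_zero,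
        hk, map_add, map_sub, translate_single, add_comm b₁ b₀, hb]
      abel
    rw [hke]
    obtain ⟨y, P', rfl⟩ := List.exists_cons_of_ne_nil hne
    obtain ⟨z, hz, hz'⟩ := D.exists_chainBd_eq (hP y (by simp)) b₀
    have := D.diffs_act_sub_act_mem_Eid P' (fun x hx => hP x (by simp [hx]))
      (i := D.cell s) (j := y.1) (by
        rintro ⟨x, h1, h2, h3⟩
        exact hov ⟨x, List.forall_mem_cons.2 ⟨h3, h1⟩, h2⟩) hk1 hz
    rw [hk0, map_zero, AddMonoidHom.zero_apply, sub_zero, hz', map_sub, AddMonoidHom.sub_apply,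
      act_single, act_single] at this
    rw [List.map_cons, diffs_cons, diff_diffs, diff_apply, translate_translate]
    exact this
  · obtain ⟨⟨i', g⟩, hy, rfl⟩ := List.mem_map.1 hi
    obtain ⟨l₁, l₂, rfl⟩ := List.append_of_mem hy
    simp only at *
    have hg : g ∈ D.config i' := hP (i', g) (by simp)
    have hsi : D.cell s ≠ i' := fun h => hnd.1 (h ▸ hi)
    have hP' : ∀ x ∈ l₁ ++ l₂, x.2 ∈ D.config x.1 := fun x hx => hP x (by
      rcases List.mem_append.1 hx with h | h <;> simp [h])
    have hi' : i' ∉ (l₁ ++ l₂).map Prod.fst := by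
      have h2 := hnd.2
      rw [List.map_append, List.map_cons, List.nodup_middle] at h2
      rw [List.map_append]
      exact (List.nodup_cons.1 h2).1
    rw [hsplit, D.cone_chainBd_diffs i' Θ _ hP' hi', ← map_sub]
    -- Θ (b₁ + g) - Θ b₁ has boundary [b₁ + g] - [b₁]. This boundary acts on θ(s, b₀) as d_g θ(s,
    -- b), while the boundary of θ(s, b₀) acts on the chain to give the cone term, so symmetry is
    -- the whole claim.
    have hbg := hΘ _ (add_mem hb₁ hg)
    have := D.diffs_act_sub_act_mem_Eid (l₁ ++ l₂) hP' (i := D.cell s) (j := i') (by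
        rintro ⟨x, h1, h2, h3⟩
        refine hov ⟨x, fun y hy => ?_, h2⟩
        rcases List.mem_append.1 hy with h | h
        · exact h1 y (by simp [h])
        · rcases List.mem_cons.1 h with rfl | h
          · exact h3
          · exact h1 y (by simp [h])) (D.single_mem_expr s b₀) (sub_mem hbg.1 (hΘ _ hb₁).1)
    convert this using 2
    have p1 : D.proj {i'}ᶜ g = 0 := D.proj_of_mem_config_of_notMem hg (by simp)
    have p2 : D.proj {i'} g = g := D.proj_of_mem_config hg rfl
    have p3 : D.proj {i'}ᶜ (m.bd s) = m.bd s := D.proj_bd_of_mem _ s hsi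
    have p4 : D.proj {i'} (m.bd s) = 0 := D.proj_bd_of_notMem _ s hsi
    rw [map_sub, hbg.2, (hΘ _ hb₁).2, chainBd_single, diff_apply, translate_single, map_sub,
      map_sub, cone_chainBd_single, cone_chainBd_single]
    have p5 : D.proj {i'}ᶜ b = b₀ := rfl
    have p6 : D.proj {i'} b = b₁ := rfl
    simp only [map_sub, map_add, p1, p2, p3, p4, p5, p6, add_zero, AddMonoidHom.sub_apply,
      act_single, translate_single, ← add_assoc, hb]
    abel

end CellDecomposition

end ExcitationModel

/-! ### Inclusion-exclusion over the cells and triviality of the statistics. -/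

namespace ExcitationModel

universe u v w

variable {M : Type w} {m : ExcitationModel.{u, v, w} M}

namespace CellDecomposition

variable {ι : Type*} (D : m.CellDecomposition ι)

open Classical in
/-- The projection of expressions to a set of cells. -/
noncomputable def projExpr (U : Set ι) : m.Expr →+ m.Expr :=
  Finsupp.liftAddHom fun x =>
    if D.cell x.1 ∈ U then Finsupp.singleAddHom (x.1, D.proj U x.2) else 0

theorem projExpr_single_of_mem {U : Set ι} {s : m.S} (h : D.cell s ∈ U) (a : m.A) :
    D.projExpr U (Finsupp.single (s, a) 1) = Finsupp.single (s, D.proj U a) 1 := by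
  simp [projExpr, h]

theorem projExpr_single_of_notMem {U : Set ι} {s : m.S} (h : D.cell s ∉ U) (a : m.A) :
    D.projExpr U (Finsupp.single (s, a) 1) = 0 := by
  simp [projExpr, h]

theorem projExpr_projExpr (U V : Set ι) (e : m.Expr) :
    D.projExpr U (D.projExpr V e) = D.projExpr (U ∩ V) e := by
  have : (D.projExpr U).comp (D.projExpr V) = D.projExpr (U ∩ V) := by
    refine m.hom_ext fun s a => ?_
    by_cases hV : D.cell s ∈ V
    · by_cases hU : D.cell s ∈ U
      · rw [AddMonoidHom.comp_apply, D.projExpr_single_of_mem hV, D.projExpr_single_of_mem hU,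
          D.projExpr_single_of_mem (U := U ∩ V) ⟨hU, hV⟩, proj_proj]
      · rw [AddMonoidHom.comp_apply, D.projExpr_single_of_mem hV, D.projExpr_single_of_notMem hU,
          D.projExpr_single_of_notMem (U := U ∩ V) fun h => hU h.1]
    · rw [AddMonoidHom.comp_apply, D.projExpr_single_of_notMem hV, map_zero,
        D.projExpr_single_of_notMem (U := U ∩ V) fun h => hV h.2]
  exact DFunLike.congr_fun this e

theorem chainBd_projExpr (U : Set ι) (e : m.Expr) :
    m.chainBd (D.projExpr U e) = Finsupp.mapDomain (D.proj U) (m.chainBd e) := by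
  have : m.chainBd.comp (D.projExpr U) =
      (Finsupp.mapDomain.addMonoidHom (D.proj U)).comp m.chainBd := by
    refine m.hom_ext fun s a => ?_
    rw [AddMonoidHom.comp_apply, AddMonoidHom.comp_apply, chainBd_single, map_sub,
      Finsupp.mapDomain.addMonoidHom_apply, Finsupp.mapDomain.addMonoidHom_apply,
      Finsupp.mapDomain_single, Finsupp.mapDomain_single, map_add]
    by_cases h : D.cell s ∈ U
    · rw [D.projExpr_single_of_mem h, chainBd_single, D.proj_bd_of_mem U s h]
    · rw [D.projExpr_single_of_notMem h, D.proj_bd_of_notMem U s h, map_zero, add_zero, sub_self]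
  exact DFunLike.congr_fun this e

/-- The complementary projections for a list of cells. -/
noncomputable def deltas : List ι → m.Expr →+ m.Expr
  | [] => AddMonoidHom.id _
  | i :: L => (AddMonoidHom.id _ - D.projExpr {i}ᶜ).comp (deltas L)

@[simp]
theorem deltas_nil (e : m.Expr) : D.deltas [] e = e := rfl

theorem deltas_cons (i : ι) (L : List ι) (e : m.Expr) :
    D.deltas (i :: L) e = D.deltas L e - D.projExpr {i}ᶜ (D.deltas L e) := rfl

theorem projExpr_translate {i j : ι} (hj : j ≠ i) {b : m.A} (hb : b ∈ D.config j) (e : m.Expr) :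
    D.projExpr {i}ᶜ (m.translate b e) = m.translate b (D.projExpr {i}ᶜ e) := by
  have : (D.projExpr {i}ᶜ).comp (m.translate b) = (m.translate b).comp (D.projExpr {i}ᶜ) := by
    refine m.hom_ext fun s a => ?_
    by_cases h : D.cell s ∈ ({i}ᶜ : Set ι)
    · simp only [AddMonoidHom.comp_apply, translate_single, D.projExpr_single_of_mem h, map_add,
        D.proj_of_mem_config hb (show j ∈ ({i}ᶜ : Set ι) from hj)]
    · simp only [AddMonoidHom.comp_apply, translate_single, D.projExpr_single_of_notMem h,
        map_zero]
  exact DFunLike.congr_fun this e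

theorem projExpr_diffs {i : ι} (P : List (ι × m.A)) (hP : ∀ x ∈ P, x.2 ∈ D.config x.1)
    (hi : i ∉ P.map Prod.fst) (e : m.Expr) :
    D.projExpr {i}ᶜ (m.diffs (P.map Prod.snd) e) =
      m.diffs (P.map Prod.snd) (D.projExpr {i}ᶜ e) := by
  induction P with
  | nil => rfl
  | cons x P ih =>
    rw [List.map_cons, List.mem_cons, not_or] at hi
    rw [List.map_cons, diffs_cons, diffs_cons, diff_apply, map_sub,
      D.projExpr_translate (Ne.symm hi.1) (hP x (by simp)),
      ih (fun y hy => hP y (by simp [hy])) hi.2, ← diff_apply]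

-- Removing the i-component of b from θ(s, b) and subtracting is a difference along that component
-- when i is not the cell of s. For the cell of s itself the projection gives 0, so nothing happens.
open Classical in
theorem exists_deltas_single (L : List ι) (hL : L.Nodup) (s : m.S) (a : m.A) :
    ∃ (P : List (ι × m.A)) (b : m.A), (∀ x ∈ P, x.2 ∈ D.config x.1) ∧
      P.map Prod.fst = L.filter (· ≠ D.cell s) ∧
      D.deltas L (Finsupp.single (s, a) 1) =
        m.diffs (P.map Prod.snd) (Finsupp.single (s, b) 1) := by
  induction L with
  | nil => exact ⟨[], a, by simp, by simp, rfl⟩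
  | cons i L ih =>
    rw [List.nodup_cons] at hL
    obtain ⟨P, b, hP, hPL, h⟩ := ih hL.2
    have hi : i ∉ P.map Prod.fst := by
      rw [hPL]
      exact fun h => hL.1 (List.mem_of_mem_filter h)
    rw [deltas_cons, h, D.projExpr_diffs P hP hi, ← map_sub]
    by_cases his : i = D.cell s
    · refine ⟨P, b, hP, ?_, ?_⟩
      · rw [hPL, List.filter_cons_of_neg (by simpa using his)]
      · rw [D.projExpr_single_of_notMem (by simp [his]), sub_zero]
    · refine ⟨(i, D.proj {i} b) :: P, D.proj {i}ᶜ b, ?_, ?_, ?_⟩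
      · exact List.forall_mem_cons.2 ⟨D.proj_mem_config i b, hP⟩
      · rw [List.map_cons, hPL, List.filter_cons_of_pos (by simpa using his)]
      · rw [D.projExpr_single_of_mem (show D.cell s ∈ ({i}ᶜ : Set ι) from Ne.symm his),
          List.map_cons, diffs_cons, diff_diffs, diff_apply, translate_single,
          D.proj_compl_add_proj]

/-- The closed expressions which vanish on every set of cells with a common point. -/
noncomputable def inv : AddSubgroup m.Expr :=
  m.chainBd.ker ⊓ ⨅ (U : Set ι) (_ : ∃ x, ∀ i ∈ U, x ∈ D.region i), (D.projExpr U).ker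

theorem mem_inv {e : m.Expr} : e ∈ D.inv ↔ m.chainBd e = 0 ∧
    ∀ U : Set ι, (∃ x, ∀ i ∈ U, x ∈ D.region i) → D.projExpr U e = 0 := by
  simp only [inv, AddSubgroup.mem_inf, AddSubgroup.mem_iInf, AddMonoidHom.mem_ker]

theorem projExpr_mem_inv {e : m.Expr} (he : e ∈ D.inv) (U : Set ι) : D.projExpr U e ∈ D.inv := by
  rw [mem_inv] at he ⊢
  refine ⟨by rw [chainBd_projExpr, he.1, Finsupp.mapDomain_zero], fun V ⟨x, hx⟩ => ?_⟩
  rw [projExpr_projExpr]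
  exact he.2 _ ⟨x, fun i hi => hx i hi.1⟩

theorem deltas_mem_inv {e : m.Expr} (he : e ∈ D.inv) (L : List ι) : D.deltas L e ∈ D.inv := by
  induction L with
  | nil => exact he
  | cons i L ih => exact sub_mem ih (D.projExpr_mem_inv ih _)

theorem projExpr_deltas (U : Set ι) (L : List ι) (e : m.Expr) :
    D.projExpr U (D.deltas L e) = D.deltas L (D.projExpr U e) := by
  induction L with
  | nil => rfl
  | cons i L ih =>
    rw [deltas_cons, map_sub, deltas_cons, ← ih, projExpr_projExpr, projExpr_projExpr, inter_comm]

/-- Each term becomes a difference in all cells of W but its own, so the contraction applies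
termwise; closedness of the total removes the cone. -/
theorem deltas_mem_Eid (hne : ∀ s, (m.supp s).Nonempty) {W : Finset ι}
    (hov : ¬ ∃ x, ∀ i ∈ W, x ∈ D.region i) (hW : W.Nonempty) {e : m.Expr}
    (he : m.chainBd (D.deltas W.toList e) = 0) (heW : D.projExpr W e = e) :
    D.deltas W.toList e ∈ m.Eid := by
  classical
  obtain ⟨i, hi⟩ := hW
  obtain ⟨h, hh⟩ := D.exists_contraction i
  have key : ∀ e, D.deltas W.toList (D.projExpr W e) -
      h (m.chainBd (D.deltas W.toList (D.projExpr W e))) ∈ m.Eid := by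
    intro e
    induction e using Finsupp.induction_linear with
    | zero => simp only [map_zero, sub_zero]; exact zero_mem _
    | add x y hx hy =>
      simp only [map_add]
      rw [add_sub_add_comm]
      exact add_mem hx hy
    | single x n =>
      obtain ⟨s, a⟩ := x
      have hn : Finsupp.single (s, a) n = n • Finsupp.single (s, a) (1 : ℤ) := by simp
      rw [hn]
      simp only [map_zsmul]
      rw [← zsmul_sub]
      refine zsmul_mem ?_ n
      by_cases hs : D.cell s ∈ (W : Set ι)
      · rw [D.projExpr_single_of_mem hs]
        obtain ⟨P, b, hP, hPW, hb⟩ := D.exists_deltas_single W.toList W.nodup_toList s (D.proj W a)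
        have hmem : ∀ j, j ∈ D.cell s :: P.map Prod.fst ↔ j ∈ W := by
          intro j
          rw [hPW, List.mem_cons, List.mem_filter, Finset.mem_toList]
          constructor
          · rintro (rfl | h)
            exacts [hs, h.1]
          · intro h
            by_cases hj : j = D.cell s
            exacts [Or.inl hj, Or.inr ⟨h, by simpa using hj⟩]
        have hov' : ¬ ∃ x, (∀ y ∈ P, x ∈ D.region y.1) ∧ x ∈ D.region (D.cell s) := by
          rintro ⟨x, hx, hxs⟩
          refine hov ⟨x, fun j hj => ?_⟩
          rcases List.mem_cons.1 ((hmem j).2 hj) with rfl | hj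
          · exact hxs
          · obtain ⟨y, hy, rfl⟩ := List.mem_map.1 hj
            exact hx y hy
        rw [hb]
        refine hh P s b hP ?_ ?_ ((hmem i).2 hi) hov'
        -- With P empty, W would be the single cell of s, whose nonempty support provides a common
        -- point.
        · rintro rfl
          obtain ⟨x, hx⟩ := hne s
          rw [D.supp_eq] at hx
          exact hov' ⟨x, by simp, hx⟩
        · rw [List.nodup_cons, hPW]
          exact ⟨by simp, W.nodup_toList.filter _⟩
      · rw [D.projExpr_single_of_notMem hs]
        simp only [map_zero, sub_zero]
        exact zero_mem _
  have := key e
  rwa [heW, he, map_zero, sub_zero] at this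

/-- The operators 1 - p, with p the projection omitting one cell, change e only by invariant
expressions on W minus a cell, which are covered by induction. What remains after all cells are
treated falls to the contraction. -/
theorem mem_Eid_of_mem_inv (hne : ∀ s, (m.supp s).Nonempty) (W : Finset ι) :
    ∀ e ∈ D.inv, D.projExpr W e = e → e ∈ m.Eid := by
  classical
  induction W using Finset.strongInduction with
  | H W ih =>
    intro e he heW
    by_cases hov : ∃ x, ∀ i ∈ W, x ∈ D.region i
    · rw [← heW, ((D.mem_inv).1 he).2 W hov]
      exact zero_mem _
    rcases W.eq_empty_or_nonempty with rfl | hW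
    · have : D.projExpr ((∅ : Finset ι) : Set ι) = 0 :=
        m.hom_ext fun s a => D.projExpr_single_of_notMem (by simp) a
      rw [← heW, this]
      exact zero_mem _
    have hL : ∀ L : List ι, (∀ i ∈ L, i ∈ W) → e - D.deltas L e ∈ m.Eid := by
      intro L hL
      induction L with
      | nil => rw [deltas_nil, sub_self]; exact zero_mem _
      | cons i L ihL =>
        rw [deltas_cons, sub_sub_eq_add_sub, add_sub_right_comm]
        refine add_mem (ihL fun j hj => hL j (by simp [hj])) ?_
        refine ih (W.erase i) (Finset.erase_ssubset (hL i (by simp))) _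
          (D.projExpr_mem_inv (D.deltas_mem_inv he L) _) ?_
        have h1 : D.projExpr W (D.deltas L e) = D.deltas L e := by rw [projExpr_deltas, heW]
        rw [← h1]
        simp only [projExpr_projExpr]
        congr 1
        congr 1
        ext j
        simp only [Finset.coe_erase, mem_inter_iff, Set.mem_sdiff, mem_compl_iff]
        tauto
    have h1 := hL W.toList (fun i hi => Finset.mem_toList.1 hi)
    have h2 := D.deltas_mem_Eid hne hov hW
      ((D.mem_inv.1 (D.deltas_mem_inv he W.toList)).1) heW
    have := add_mem h1 h2
    rwa [sub_add_cancel] at this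

theorem exists_finset_proj_eq (a : m.A) :
    ∃ W : Finset ι, ∀ U : Set ι, (W : Set ι) ⊆ U → D.proj U a = a := by
  classical
  have ha : a ∈ AddSubgroup.closure (range m.bd) := by rw [m.generates]; trivial
  induction ha using AddSubgroup.closure_induction with
  | mem a ha =>
    obtain ⟨s, rfl⟩ := ha
    exact ⟨{D.cell s}, fun U hU => D.proj_bd_of_mem U s (hU (by simp))⟩
  | zero => exact ⟨∅, fun U _ => map_zero _⟩
  | add a b _ _ ha hb =>
    obtain ⟨W, hW⟩ := ha
    obtain ⟨W', hW'⟩ := hb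
    refine ⟨W ∪ W', fun U hU => ?_⟩
    rw [Finset.coe_union, union_subset_iff] at hU
    rw [map_add, hW U hU.1, hW' U hU.2]
  | neg a _ ha =>
    obtain ⟨W, hW⟩ := ha
    exact ⟨W, fun U hU => by rw [map_neg, hW U hU]⟩

theorem exists_finset_projExpr_eq (e : m.Expr) :
    ∃ W : Finset ι, ∀ U : Set ι, (W : Set ι) ⊆ U → D.projExpr U e = e := by
  classical
  induction e using Finsupp.induction_linear with
  | zero => exact ⟨∅, fun U _ => map_zero _⟩
  | add a b ha hb =>
    obtain ⟨W, hW⟩ := ha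
    obtain ⟨W', hW'⟩ := hb
    refine ⟨W ∪ W', fun U hU => ?_⟩
    rw [Finset.coe_union, union_subset_iff] at hU
    rw [map_add, hW U hU.1, hW' U hU.2]
  | single x n =>
    obtain ⟨s, a⟩ := x
    obtain ⟨W, hW⟩ := D.exists_finset_proj_eq a
    refine ⟨insert (D.cell s) W, fun U hU => ?_⟩
    rw [Finset.coe_insert, insert_subset_iff] at hU
    have hn : Finsupp.single (s, a) n = n • Finsupp.single (s, a) (1 : ℤ) := by simp
    rw [hn, map_zsmul, D.projExpr_single_of_mem hU.1, hW U hU.2]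

/-- For V the operators in the cells of U, projecting configurations to U kills everything created
outside V, so the projection of expressions factors through `restrict V`. -/
theorem Einv_le_inv : m.Einv ≤ D.inv := by
  classical
  intro e he
  refine D.mem_inv.2 ⟨he.1, fun U ⟨x, hx⟩ => ?_⟩
  let V : Set m.S := {s | D.cell s ∈ U}
  have hV : m.restrict V e = 0 := he.2 V ⟨x, fun s hs => by rw [D.supp_eq]; exact hx _ hs⟩
  have hker : m.remote V ≤ (D.proj U).ker := by
    refine (AddSubgroup.closure_le _).2 ?_
    rintro _ ⟨s, hs, rfl⟩
    exact D.proj_bd_of_notMem U s hs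
  let ρ : ((V × (m.A ⧸ m.remote V)) →₀ ℤ) →+ m.Expr :=
    Finsupp.liftAddHom fun y =>
      Finsupp.singleAddHom ((y.1 : m.S), QuotientAddGroup.lift (m.remote V) (D.proj U) hker y.2)
  have : D.projExpr U = ρ.comp (m.restrict V) := by
    refine m.hom_ext fun s a => ?_
    by_cases hs : D.cell s ∈ U
    · have h1 : Finsupp.subtypeDomainAddMonoidHom (p := fun x : m.S × m.A => x.1 ∈ V)
          (Finsupp.single (s, a) (1 : ℤ)) = Finsupp.single ⟨(s, a), hs⟩ 1 := by
        ext y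
        change Finsupp.single (s, a) (1 : ℤ) (y : m.S × m.A) = _
        simp [Finsupp.single_apply, Subtype.ext_iff]
      rw [D.projExpr_single_of_mem hs, AddMonoidHom.comp_apply, restrict, AddMonoidHom.comp_apply,
        h1]
      simp [ρ]
    · have h1 : Finsupp.subtypeDomainAddMonoidHom (p := fun x : m.S × m.A => x.1 ∈ V)
          (Finsupp.single (s, a) (1 : ℤ)) = 0 := by
        ext y
        refine Finsupp.single_eq_of_ne fun h => hs ?_
        have := y.2
        rw [h] at this
        exact this
      rw [D.projExpr_single_of_notMem hs, AddMonoidHom.comp_apply, restrict,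
        AddMonoidHom.comp_apply, h1, map_zero, map_zero]
  rw [this, AddMonoidHom.comp_apply, hV, map_zero]

/-- A model which decomposes into independent cells has trivial statistics. -/
theorem subsingleton_statistics (D : m.CellDecomposition ι) (hne : ∀ s, (m.supp s).Nonempty) :
    Subsingleton m.Statistics := by
  refine ⟨fun a b => ?_⟩
  induction a using QuotientAddGroup.induction_on with | H a => ?_
  induction b using QuotientAddGroup.induction_on with | H b => ?_
  rw [QuotientAddGroup.eq, AddSubgroup.mem_addSubgroupOf]
  obtain ⟨W, hW⟩ := D.exists_finset_projExpr_eq ((-a + b : m.Einv) : m.Expr)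
  exact D.mem_Eid_of_mem_inv hne W _ (D.Einv_le_inv (-a + b : m.Einv).2) (hW W le_rfl)

end CellDecomposition

end ExcitationModel

/-! ### The lattice model as a model of independent cells. -/

open ExcitationModel RelCWComplex in
theorem subsingleton_statistics_latticeModel {X : Type*} [TopologicalSpace X] [T2Space X]
    {C : Set X} [CWComplex C] (o : CellOrientation C) (q : ℕ) {G : Type*} [AddCommGroup G]
    (G₀ : Set G) (hG₀ : AddSubgroup.closure G₀ = ⊤) {M : Type*} (f : skeleton C q → M)
    (hinj : Function.Injective (cellularBoundary o q G)) :
    Subsingleton (latticeModel o q G₀ hG₀ f).Statistics := by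
  classical
  let κ : (cell C q →₀ G) ≃+ (cellularBoundary o q G).range := AddMonoidHom.ofInjective hinj
  have hκ : ∀ (c : cell C q) (g : G), κ.symm (cellBoundary o q G c g) = Finsupp.single c g :=
    fun c g => κ.symm_apply_eq.2 rfl
  let D : (latticeModel o q G₀ hG₀ f).CellDecomposition (cell C q) :=
    { cell := Prod.fst
      region := fun c => f '' {x | (x : X) ∈ closedCell q c}
      supp_eq := fun s => rfl
      -- Independence identifies configurations with chains, and chains are projected by discarding
      -- the coefficients off U.
      proj := fun U => κ.toAddMonoidHom.comp
        ((Finsupp.filterAddHom (· ∈ U)).comp κ.symm.toAddMonoidHom)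
      proj_bd_of_mem := fun U s hs => by
        change κ (Finsupp.filter (· ∈ U) (κ.symm (cellBoundary o q G s.1 s.2))) = _
        rw [hκ, Finsupp.filter_single_of_pos _ hs, ← hκ, κ.apply_symm_apply]
        rfl
      proj_bd_of_notMem := fun U s hs => by
        change κ (Finsupp.filter (· ∈ U) (κ.symm (cellBoundary o q G s.1 s.2))) = _
        rw [hκ, Finsupp.filter_single_of_neg _ hs, map_zero]
        rfl }
  refine D.subsingleton_statistics fun s => ?_
  exact ⟨_, ⟨_, closedCell_subset_skeleton q s.1 (map_zero_mem_closedCell q s.1)⟩,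
    map_zero_mem_closedCell q s.1, rfl⟩

end ExcitationStatistics

theorem mainTheorem10 {X : Type*} [TopologicalSpace X] [T2Space X]
    (C : Set X) [CWComplex C] (hC : IsRegular C) (o : CellOrientation C)
    {G : Type*} [AddCommGroup G] (G₀ : Set G) (hG₀ : AddSubgroup.closure G₀ = ⊤) (d : ℕ) :
    (∀ f : RelCWComplex.skeleton C d → Euc d, IsEmbedding f →
      Function.Injective (cellularBoundary o d G) ∧
      Subsingleton (latticeModel o d G₀ hG₀ f).Statistics) ∧
    (∀ q : ℕ, q < d →
      (∀ f : RelCWComplex.skeleton C q → Euc d, IsEmbedding f →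
        ∃ (y : Sph d) (j : Euc d ≃ₜ {z : Sph d // z ≠ y}),
          IsEmbedding fun x => (j (f x) : Sph d)) ∧
      (∀ g : RelCWComplex.skeleton C q → Sph d, IsEmbedding g →
        ∃ (y : Sph d) (j : Euc d ≃ₜ {z : Sph d // z ≠ y})
          (f : RelCWComplex.skeleton C q → Euc d),
          IsEmbedding f ∧ ∀ x, g x = j (f x)) ∧
      (∀ (f : RelCWComplex.skeleton C q → Euc d) (g : RelCWComplex.skeleton C q → Sph d),
        IsEmbedding f → IsEmbedding g →
        ∃ φ : (latticeModel o q G₀ hG₀ f).Statistics ≃+ (latticeModel o q G₀ hG₀ g).Statistics,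
          ∀ (e : (latticeModel o q G₀ hG₀ f).Expr)
            (he : e ∈ (latticeModel o q G₀ hG₀ f).Einv),
            ∃ he' : e ∈ (latticeModel o q G₀ hG₀ g).Einv,
              φ ((latticeModel o q G₀ hG₀ f).statClass ⟨e, he⟩) =
                (latticeModel o q G₀ hG₀ g).statClass ⟨e, he'⟩)) := by
  have : Nonempty (Sph d) := (NormedSpace.sphere_nonempty.2 zero_le_one).to_subtype
  refine ⟨fun f hf => ?_, fun q hq => ⟨fun f hf => ?_, fun g hg => ?_, fun f g hf hg => ?_⟩⟩
  · have hinj := cellularBoundary_injective hC o hf G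
    exact ⟨hinj, subsingleton_statistics_latticeModel o d G₀ hG₀ f hinj⟩
  · obtain ⟨y⟩ := this
    obtain ⟨j⟩ := nonempty_homeomorph_sphere_ne d y
    exact ⟨y, j, IsEmbedding.subtypeVal.comp (j.isEmbedding.comp hf)⟩
  · exact exists_homeomorph_comp_of_isEmbedding_sphere hC hq hg
  · exact exists_statistics_equiv o q G₀ hG₀ hf.injective hg.injective
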